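/- Let $G$ be a finite graph with maximum degree $\Delta$ and arboricity $\alpha$ (the least number of forests into which its edges can be partitioned), and let $p\ge 1$ be a real number. Write $\log$ for the base-$2$ and $\ln$ for the natural logarithm, and set $$\Theta=\Big\lfloor \log\frac{\Delta}{1176\cdot 16\,\alpha^{10}\ln^2\Delta}\Big\rfloor,\qquad \Lambda=\big\lceil p\cdot 8\alpha^2(32\alpha^6+1)\ln(260\,\alpha^4\ln^2\Delta)\big\rceil,\qquad \rho_k=\frac{8\,\Delta\ln\Delta}{2^{k+1}}.$$ Consider the following randomized algorithm. It maintains sets $I,B\subseteq V(G)$, initially empty, and a set $A$ of active nodes, initially $V(G)$; $\Gamma_A(u)$ denotes the set of neighbors of $u$ in $A$, and $\deg_A(u)=|\Gamma_A(u)|$. In each scale $k=1,2,\dots,\Theta$ it does the following. (a) It performs $\Lambda$ iterations. In each iteration, every $u\in A$ gets the priority $r(u)=0$ if $\deg_A(u)>\rho_k$, and otherwise a priority $r(u)$ chosen uniformly at random in $(0,1)$, all choices being independent; every $u\in A$ with $r(u)>r(w)$ for all $w\in\Gamma_A(u)$ is added to $I$; these nodes and all their neighbors in $A$ are then removed from $A$.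 (b) After the $\Lambda$ iterations, every $u\in A$ with $|\{w\in\Gamma_A(u):\deg_A(w)>\Delta/2^k+\alpha\}|>\Delta/2^{k+2}$ is added to $B$, and all these nodes are removed from $A$ simultaneously. Then for every scale $1\le k\le\Theta$ and every node $v$: 1. conditionally on $v$ being active at the start of scale $k$, the probability that $v$ is added to $B$ in scale $k$ is at most $1/\Delta^{2p}$; 2. this bound does not depend on the random choices made outside the $3$-neighborhood of $v$: fix arbitrarily in $(0,1)$ all random choices of all nodes in all scales other than $k$, such that $v$ is active at the start of scale $k$, and fix arbitrarily in $(0,1)$ the random choices in scale $k$ of all nodes at distance more than $3$ from $v$ in $G$. Then, over the independent uniform choices in scale $k$ of the nodes at distance at most $3$ from $v$ (including $v$), the probability that $v$ is added to $B$ in scale $k$ is still at most $1/\Delta^{2p}$. -/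

import Mathlib

open MeasureTheory

namespace BoundedArb

/-- The edges of `G` can be partitioned into `a` forests (on the vertex set of `G`). -/
def HasForestPartition {V : Type*} (G : SimpleGraph V) (a : ℕ) : Prop :=
  ∃ F : Fin a → SimpleGraph V,
    (∀ i, (F i).IsAcyclic) ∧
    (∀ i j, i ≠ j → Disjoint (F i).edgeSet (F j).edgeSet) ∧
    (⋃ i, (F i).edgeSet) = G.edgeSet

/-- The arboricity of `G`: the minimum number of forests that the edges of `G` can be
partitioned into (such a number exists for every finite graph). -/
noncomputable def arboricity {V : Type*} (G : SimpleGraph V) : ℕ :=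
  sInf {a : ℕ | HasForestPartition G a}

section Algorithm

/-- A state of the algorithm: the independent set `I`, the set `B` of bad nodes, and the set
`active` of active nodes (written `V_IB`). -/
structure State (V : Type*) where
  I : Finset V
  B : Finset V
  active : Finset V

/-- The random reals used by the algorithm: `ω (k, i, v)` is the real in `(0,1)` that is available
to node `v` in iteration `i` (counted from `0`) of scale `k` (counted from `1`). -/
abbrev Choices (V : Type*) := ℕ × ℕ × V → ℝ

variable {V : Type*} [Fintype V] [DecidableEq V] (G : SimpleGraph V) [DecidableRel G.Adj]

/-- The maximum degree of the input graph, as a real number. -/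
noncomputable def maxDeg : ℝ := (G.maxDegree : ℝ)

/-- The number of scales, `⌊log₂ (Δ / (1176 · 16 α¹⁰ ln² Δ))⌋`
(no scale at all if this is negative). -/
noncomputable def numScales (α : ℕ) : ℕ :=
  ⌊Real.logb 2 (maxDeg G / (1176 * 16 * (α : ℝ) ^ 10 * Real.log (maxDeg G) ^ 2))⌋₊

/-- The number of iterations in every scale,
`⌈p · 8α² (32α⁶ + 1) · ln (260 α⁴ ln² Δ)⌉`. -/
noncomputable def numIters (α : ℕ) (p : ℝ) : ℕ :=
  ⌈p * (8 * (α : ℝ) ^ 2 * (32 * (α : ℝ) ^ 6 + 1)) *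
    Real.log (260 * (α : ℝ) ^ 4 * Real.log (maxDeg G) ^ 2)⌉₊

/-- The competitiveness threshold of scale `k`, `8 ln Δ · Δ / 2^(k+1)`. -/
noncomputable def rho (k : ℕ) : ℝ := 8 * Real.log (maxDeg G) * maxDeg G / 2 ^ (k + 1)

/-- The neighbors of `v` in the set `A` of active nodes. -/
def activeNbrs (A : Finset V) (v : V) : Finset V := {w ∈ A | G.Adj v w}

/-- The degree of `v` with respect to the set `A` of active nodes. -/
def activeDeg (A : Finset V) (v : V) : ℕ := (activeNbrs G A v).card

/-- The priority of `v` in an iteration of scale `k` that starts with the active set `A`, when the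
random reals available in this iteration are `x`. -/
noncomputable def priority (k : ℕ) (A : Finset V) (x : V → ℝ) (v : V) : ℝ :=
  if (activeDeg G A v : ℝ) > rho G k then 0 else x v

/-- The active nodes whose priority exceeds those of all their active neighbors
(an active node without active neighbors is one of them). -/
noncomputable def joining (k : ℕ) (A : Finset V) (x : V → ℝ) : Finset V :=
  {v ∈ A | ∀ w ∈ activeNbrs G A v, priority G k A x w < priority G k A x v}

/-- One iteration of scale `k`: the joining nodes enter `I`, and they and their active neighbors
become inactive. -/
noncomputable def iterStep (k : ℕ) (x : V → ℝ) (s : State V) : State V where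
  I := s.I ∪ joining G k s.active x
  B := s.B
  active := s.active \
    (joining G k s.active x ∪ (joining G k s.active x).biUnion (activeNbrs G s.active))

/-- The state after the first `i` iterations of scale `k`, which starts in state `s`. -/
noncomputable def afterIters (k : ℕ) (ω : Choices V) (s : State V) : ℕ → State V
  | 0 => s
  | i + 1 => iterStep G k (fun v => ω (k, i, v)) (afterIters k ω s i)

/-- The active neighbors of `v` of active degree more than `Δ / 2^k + α`. -/
noncomputable def highDegNbrs (α k : ℕ) (A : Finset V) (v : V) : Finset V :=
  {w ∈ activeNbrs G A v | (activeDeg G A w : ℝ) > maxDeg G / 2 ^ k + α}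

/-- The active nodes that are marked bad in scale `k`: those having more than `Δ / 2^(k+2)`
neighbors of high degree. -/
noncomputable def marked (α k : ℕ) (A : Finset V) : Finset V :=
  {v ∈ A | ((highDegNbrs G α k A v).card : ℝ) > maxDeg G / 2 ^ (k + 2)}

/-- The end of scale `k`: the marked nodes enter `B` and become inactive. -/
noncomputable def markStep (α k : ℕ) (s : State V) : State V where
  I := s.I
  B := s.B ∪ marked G α k s.active
  active := s.active \ marked G α k s.active

/-- The state at the end of scale `k`, equivalently at the start of scale `k + 1`. At the end of
scale `0`, i.e. initially, all nodes are active. -/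
noncomputable def afterScale (α : ℕ) (p : ℝ) (ω : Choices V) : ℕ → State V
  | 0 => ⟨∅, ∅, Finset.univ⟩
  | k + 1 => markStep G α (k + 1)
      (afterIters G (k + 1) ω (afterScale α p ω k) (numIters G α p))

end Algorithm

/-- The uniform distribution on `(0,1)`. -/
noncomputable def uniform01 : Measure ℝ := volume.restrict (Set.Ioo 0 1)

instance : IsProbabilityMeasure uniform01 := ⟨by simp [uniform01]⟩

/-- The law of the random reals: they are independent and uniform on `(0,1)`. -/
noncomputable def choiceMeasure (V : Type*) : Measure (Choices V) :=
  Measure.infinitePi fun _ : ℕ × ℕ × V => uniform01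

open Classical in
/-- The choices that agree with `ω` on what the nodes at distance at most `3` from `v` choose in
scale `k`, and with `ω₀` on everything else. -/
noncomputable def resampleNear {V : Type*} (G : SimpleGraph V) (v : V) (k : ℕ)
    (ω₀ ω : Choices V) : Choices V :=
  fun c => if c.1 = k ∧ G.edist v c.2.2 ≤ 3 then ω c else ω₀ c

end BoundedArb

set_option linter.unusedSectionVars false

/-! Fix `v` and `k`, and put D = Δ/2^k, ℓ = ln Δ. Call a node high if its active degree exceeds D +
α, and let X count the high active neighbors of `v`. A node `v` that is active at the start of the
scale is marked iff it is still active with X > D/4 after all iterations.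

The marking rule of the preceding scale leaves every active node with at most D/2 active neighbors
of degree above 2D + α (`Sparse`). Orient `G` with out-degree at most α, calling out-neighbors
parents. Discarding parents and neighbors of too large degree, a high node keeps at least D/2
children of degree at most 2D + α. Each child serves at most α parents, and passing to an
independent set Q of children costs a factor 2α + 1. Call a value tall if it is within τ (of order
1/D) of 1. Exposing the values outside Q first leaves at least half of Q without a tall competitor,
up to probability 1/Δ; here ρ_k bounds the influence of a single value. The values in Q are then
still fresh, and each tall survivor joins I and removes its parent. So while X > D/4 an iteration
shrinks X by the factor 1 - 1/(176α²) (`measure_many_highDegNbrs_le`). If X > C·D/4 with C =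
260α⁴ℓ², the same argument with Q among the neighbors of `v` removes `v` itself
(`measure_mem_iterActive_le`). Each of the two fails with probability at most 2/Δ.

That failure probability is too large for a union bound, so failures are averaged. With M = C·D/4,
the `potential` min(X, M)^θ, set to 0 once `v` is out of danger, never increases, and its mean
shrinks by (1 - 1/(176α²))^θ + 2/Δ per iteration. It is at most M^θ, and at least (D/4)^θ if `v`
gets marked. With C^θ = Δ^8, Markov's inequality after Λ iterations gives Δ^(8-10p) ≤ Δ^(-2p).

These bounds hold for every `Sparse` active set and use only values within distance 3 of `v`, which
gives the local claim (`measure_resampleNear_marked_le`). The conditional claim follows by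
integrating it (`cond_le_of_forall_resample`). -/

namespace BoundedArb

/-! ### Orientations of bounded out-degree and independent sets -/

section Orientation

variable {V : Type*}

/-- A forest can be oriented so that every vertex has at most one outgoing edge. -/
theorem exists_orientation_of_isAcyclic {F : SimpleGraph V} (hF : F.IsAcyclic) :
    ∃ f : V → V, ∀ u v, F.Adj u v → f u = v ∨ f v = u := by
  classical
  -- Root every component arbitrarily and send each vertex to the next one on its path to the root.
  -- By uniqueness of paths, one end of any edge is the next vertex of the other.
  let r : F.ConnectedComponent → V := fun c => c.out
  have hr : ∀ u, F.Reachable u (r (F.connectedComponentMk u)) := fun u =>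
    (SimpleGraph.ConnectedComponent.exact (F.connectedComponentMk u).out_eq).symm
  choose P hP using fun u => (hr u).exists_isPath
  have huniq : ∀ {a b : V} (p q : F.Walk a b), p.IsPath → q.IsPath → p = q := by
    intro a b p q hp hq
    exact congrArg Subtype.val ((hF.subsingleton_path a b).elim ⟨p, hp⟩ ⟨q, hq⟩)
  refine ⟨fun u => (P u).snd, fun u v huv => ?_⟩
  have hc : F.connectedComponentMk v = F.connectedComponentMk u :=
    SimpleGraph.ConnectedComponent.sound huv.symm.reachable
  by_cases hv : v ∈ (P u).support
  · left
    have h1 : (P u).takeUntil v hv = SimpleGraph.Walk.cons huv .nil := by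
      apply huniq
      · exact (hP u).takeUntil hv
      · simp [SimpleGraph.Walk.cons_isPath_iff, huv.ne]
    have h2 := (P u).take_spec hv
    rw [h1] at h2
    show (P u).snd = v
    rw [← h2]
    simp
  · right
    have h1 : (SimpleGraph.Walk.cons huv.symm (P u)).IsPath := by
      rw [SimpleGraph.Walk.cons_isPath_iff]
      exact ⟨hP u, hv⟩
    have h2 : P v = (SimpleGraph.Walk.cons huv.symm (P u)).copy rfl (by rw [hc]) := by
      apply huniq _ _ (hP v)
      simpa using h1
    show (P v).snd = u
    rw [h2]
    have : ∀ {a b b' c : V} (h : F.Adj a b) (p : F.Walk b c) (e : c = b'),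
        ((SimpleGraph.Walk.cons h p).copy rfl e).snd = b := by
      intro a b b' c h p e
      subst e
      simp
    exact this _ _ _

/-- A graph whose edges can be partitioned into `a` forests can be oriented so that every
vertex has at most `a` outgoing edges. -/
theorem HasForestPartition.exists_orientation {G : SimpleGraph V} {a : ℕ}
    (h : HasForestPartition G a) :
    ∃ par : V → Finset V, (∀ v, (par v).card ≤ a) ∧
      ∀ u v, G.Adj u v → v ∈ par u ∨ u ∈ par v := by
  classical
  obtain ⟨F, hF, -, hU⟩ := h
  choose f hf using fun i => exists_orientation_of_isAcyclic (hF i)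
  refine ⟨fun v => Finset.univ.image fun i => f i v, fun v => ?_, fun u v huv => ?_⟩
  · exact Finset.card_image_le.trans (by simp)
  · have : s(u, v) ∈ ⋃ i, (F i).edgeSet := hU ▸ huv
    obtain ⟨i, hi⟩ := Set.mem_iUnion.1 this
    rcases hf i u v hi with h | h
    · left; exact Finset.mem_image.2 ⟨i, Finset.mem_univ _, h⟩
    · right; exact Finset.mem_image.2 ⟨i, Finset.mem_univ _, h⟩

/-- In a graph with an orientation of out-degree at most `a`, every finite set `S` of vertices
has an independent subset of size at least `|S| / (2 a + 1)`. -/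
theorem exists_independent_subset {G : SimpleGraph V} {a : ℕ} {par : V → Finset V}
    (hpar : ∀ v, (par v).card ≤ a) (hG : ∀ u v, G.Adj u v → v ∈ par u ∨ u ∈ par v)
    (S : Finset V) :
    ∃ Q ⊆ S, (∀ u ∈ Q, ∀ v ∈ Q, ¬ G.Adj u v) ∧ S.card ≤ (2 * a + 1) * Q.card := by
  classical
  induction S using Finset.strongInduction with
  | H S ih =>
    rcases S.eq_empty_or_nonempty with rfl | hS
    · exact ⟨∅, by simp⟩
    -- In-degrees and out-degrees inside `S` have equal sums, so some vertex has at most `2 * a`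
    -- neighbors in `S`. It is picked and deleted together with these neighbors.
    have hin : ∑ u ∈ S, (S.filter fun z => u ∈ par z).card
        = ∑ u ∈ S, (S.filter fun z => z ∈ par u).card := by
      simp only [Finset.card_filter]
      rw [Finset.sum_comm]
    have hle : ∀ u ∈ S, (S.filter fun z => G.Adj u z).card
        ≤ (S.filter fun z => z ∈ par u).card + (S.filter fun z => u ∈ par z).card := by
      intro u _
      refine (Finset.card_le_card ?_).trans (Finset.card_union_le _ _)
      intro z hz
      simp only [Finset.mem_filter, Finset.mem_union] at hz ⊢
      rcases hG u z hz.2 with h | h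
      · exact Or.inl ⟨hz.1, h⟩
      · exact Or.inr ⟨hz.1, h⟩
    have hsum : ∑ u ∈ S, (S.filter fun z => G.Adj u z).card ≤ ∑ u ∈ S, 2 * a := by
      refine (Finset.sum_le_sum hle).trans ?_
      rw [Finset.sum_add_distrib, hin, ← two_mul, Finset.mul_sum]
      refine Finset.sum_le_sum fun u _ => Nat.mul_le_mul_left _ ?_
      refine (Finset.card_le_card fun z hz => ?_).trans (hpar u)
      exact (Finset.mem_filter.1 hz).2
    obtain ⟨u, huS, hu⟩ := Finset.exists_le_of_sum_le hS hsum
    let R := insert u (S.filter fun z => G.Adj u z)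
    have hR : R ⊆ S := Finset.insert_subset huS (Finset.filter_subset _ _)
    have hRc : R.card ≤ 2 * a + 1 := (Finset.card_insert_le _ _).trans (by omega)
    have huR : u ∈ R := Finset.mem_insert_self _ _
    have hlt : S \ R ⊂ S := Finset.sdiff_ssubset hR ⟨u, huR⟩
    obtain ⟨Q, hQS, hQ, hQc⟩ := ih _ hlt
    have huQ : u ∉ Q := fun h => (Finset.mem_sdiff.1 (hQS h)).2 huR
    have hno : ∀ z ∈ Q, ¬ G.Adj u z := fun z hz h => by
      have := Finset.mem_sdiff.1 (hQS hz)
      exact this.2 (Finset.mem_insert_of_mem (Finset.mem_filter.2 ⟨this.1, h⟩))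
    refine ⟨insert u Q, Finset.insert_subset huS (hQS.trans Finset.sdiff_subset), ?_, ?_⟩
    · intro x hx y hy hxy
      rw [Finset.mem_insert] at hx hy
      rcases hx with hx | hx <;> rcases hy with hy | hy
      · exact hxy.ne (hx.trans hy.symm)
      · exact hno y hy (hx ▸ hxy)
      · exact hno x hx (hy ▸ hxy.symm)
      · exact hQ x hx y hy hxy
    · rw [Finset.card_insert_of_notMem huQ]
      have := Finset.card_sdiff_add_card_eq_card hR
      nlinarith

end Orientation

/-! ### Deterministic properties of the algorithm -/

section Deterministic

variable {V : Type*} [Fintype V] [DecidableEq V] (G : SimpleGraph V) [DecidableRel G.Adj]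

theorem mem_activeNbrs {A : Finset V} {v w : V} : w ∈ activeNbrs G A v ↔ w ∈ A ∧ G.Adj v w := by
  simp [activeNbrs]

theorem activeNbrs_mono {A A' : Finset V} (h : A' ⊆ A) (v : V) :
    activeNbrs G A' v ⊆ activeNbrs G A v :=
  Finset.filter_subset_filter _ h

theorem activeDeg_mono {A A' : Finset V} (h : A' ⊆ A) (v : V) :
    activeDeg G A' v ≤ activeDeg G A v :=
  Finset.card_le_card (activeNbrs_mono G h v)

theorem activeDeg_le_maxDegree (A : Finset V) (v : V) : activeDeg G A v ≤ G.maxDegree := by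
  refine le_trans (Finset.card_le_card (t := G.neighborFinset v) ?_) (G.degree_le_maxDegree v)
  intro w hw
  simpa using ((mem_activeNbrs G).1 hw).2

theorem highDegNbrs_mono {A A' : Finset V} (h : A' ⊆ A) (α k : ℕ) (v : V) :
    highDegNbrs G α k A' v ⊆ highDegNbrs G α k A v := by
  intro w hw
  simp only [highDegNbrs, Finset.mem_filter] at hw ⊢
  refine ⟨activeNbrs_mono G h v hw.1, lt_of_lt_of_le hw.2 ?_⟩
  exact_mod_cast activeDeg_mono G h w

/-- The active set after an iteration of scale `k` that starts with the active set `A` and uses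
the random reals `x`. -/
noncomputable def iterActive (k : ℕ) (A : Finset V) (x : V → ℝ) : Finset V :=
  A \ (joining G k A x ∪ (joining G k A x).biUnion (activeNbrs G A))

theorem iterActive_subset (k : ℕ) (A : Finset V) (x : V → ℝ) : iterActive G k A x ⊆ A :=
  Finset.sdiff_subset

theorem notMem_iterActive_of_joining {k : ℕ} {A : Finset V} {x : V → ℝ} {u w : V}
    (hu : u ∈ joining G k A x) (huw : G.Adj u w) : w ∉ iterActive G k A x := by
  intro hw
  have := Finset.mem_sdiff.1 hw
  exact this.2 (Finset.mem_union_right _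
    (Finset.mem_biUnion.2 ⟨u, hu, (mem_activeNbrs G).2 ⟨this.1, huw⟩⟩))

/-- A competitive active node whose value exceeds a threshold that no competitive active neighbor
exceeds joins the independent set. -/
theorem mem_joining_of_tall {k : ℕ} {A : Finset V} {x : V → ℝ} {u : V} {t : ℝ} (ht : 0 ≤ t)
    (hu : u ∈ A) (hdeg : (activeDeg G A u : ℝ) ≤ rho G k) (hxu : t < x u)
    (hx : ∀ z ∈ activeNbrs G A u, (activeDeg G A z : ℝ) ≤ rho G k → x z ≤ t) :
    u ∈ joining G k A x := by
  refine Finset.mem_filter.2 ⟨hu, fun z hz => ?_⟩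
  rw [priority, priority, if_neg (not_lt.2 hdeg)]
  split_ifs with h
  · exact ht.trans_lt hxu
  · exact (hx z hz (not_lt.1 h)).trans_lt hxu

/-- The invariant at the start of scale `k`: every active node has at most `Δ / 2^(k+1)` active
neighbors of active degree more than `Δ / 2^(k-1) + α`. -/
def Sparse (α k : ℕ) (A : Finset V) : Prop :=
  ∀ y ∈ A, (({w ∈ activeNbrs G A y |
    (activeDeg G A w : ℝ) > 2 * (maxDeg G / 2 ^ k) + α} : Finset V).card : ℝ)
      ≤ maxDeg G / 2 ^ k / 2

theorem Sparse.mono {α k : ℕ} {A A' : Finset V} (hA : Sparse G α k A) (h : A' ⊆ A) :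
    Sparse G α k A' := by
  intro y hy
  refine le_trans ?_ (hA y (h hy))
  norm_cast
  refine Finset.card_le_card fun w hw => ?_
  simp only [Finset.mem_filter] at hw ⊢
  refine ⟨activeNbrs_mono G h y hw.1, lt_of_lt_of_le hw.2 ?_⟩
  exact_mod_cast activeDeg_mono G h w

/-- In scale 1 the degree threshold is Δ + α, which no node exceeds. -/
theorem sparse_one (α : ℕ) (A : Finset V) : Sparse G α 1 A := by
  intro y _
  rw [Finset.filter_false_of_mem]
  · simp only [Finset.card_empty, Nat.cast_zero]
    unfold maxDeg; positivity
  · intro w _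
    rw [not_lt]
    have : (activeDeg G A w : ℝ) ≤ maxDeg G := by
      unfold maxDeg; exact_mod_cast activeDeg_le_maxDegree G A w
    have h2 : (0 : ℝ) ≤ α := by positivity
    linarith

/-- The thresholds of scale `j + 1` are those of the marking rule of scale `j`, so an unmarked node
satisfies the invariant, and deleting the marked ones only lowers the counts. -/
theorem sparse_markStep (α j : ℕ) (s : State V) :
    Sparse G α (j + 1) (markStep G α j s).active := by
  have hsub : (markStep G α j s).active ⊆ s.active := Finset.sdiff_subset
  intro y hy
  have hy' := Finset.mem_sdiff.1 hy
  have hnm : ¬ ((highDegNbrs G α j s.active y).card : ℝ) > maxDeg G / 2 ^ (j + 2) := fun h =>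
    hy'.2 (Finset.mem_filter.2 ⟨hy'.1, h⟩)
  have e1 : maxDeg G / 2 ^ (j + 1) / 2 = maxDeg G / 2 ^ (j + 2) := by
    rw [div_div, ← pow_succ]
  have e2 : 2 * (maxDeg G / 2 ^ (j + 1)) = maxDeg G / 2 ^ j := by
    rw [pow_succ]; field_simp
  rw [e1, e2]
  exact (Nat.cast_le.2 (Finset.card_le_card (highDegNbrs_mono G hsub α j y))).trans
    (not_lt.1 hnm)

theorem afterIters_active_succ (k : ℕ) (ω : Choices V) (s : State V) (i : ℕ) :
    (afterIters G k ω s (i + 1)).active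
      = iterActive G k (afterIters G k ω s i).active fun v => ω (k, i, v) := rfl

theorem afterIters_active_subset (k : ℕ) (ω : Choices V) (s : State V) (i : ℕ) :
    (afterIters G k ω s i).active ⊆ s.active := by
  induction i with
  | zero => exact subset_rfl
  | succ i ih => exact (iterActive_subset G k _ _).trans ih

theorem afterIters_B (k : ℕ) (ω : Choices V) (s : State V) (i : ℕ) :
    (afterIters G k ω s i).B = s.B := by
  induction i with
  | zero => rfl
  | succ i ih => exact ih

theorem afterIters_congr {k : ℕ} {ω ω' : Choices V} (s : State V) {i : ℕ}
    (h : ∀ j < i, ∀ v, ω (k, j, v) = ω' (k, j, v)) :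
    afterIters G k ω s i = afterIters G k ω' s i := by
  induction i with
  | zero => rfl
  | succ i ih =>
    simp only [afterIters]
    rw [ih fun j hj v => h j (by omega) v]
    congr 1
    funext v
    exact h i (by omega) v

/-- Causality: resampling scale `k` cannot affect which nodes are active when it starts. -/
theorem afterScale_congr {α : ℕ} {p : ℝ} {ω ω' : Choices V} {k : ℕ}
    (h : ∀ j ≤ k, ∀ i v, ω (j, i, v) = ω' (j, i, v)) :
    afterScale G α p ω k = afterScale G α p ω' k := by
  induction k with
  | zero => rfl
  | succ k ih =>
    simp only [afterScale]
    rw [ih fun j hj i v => h j (by omega) i v,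
      afterIters_congr G _ fun i _ v => h (k + 1) le_rfl i v]

/-- Ensures that a node active at the start of a scale and in `B` at its end was marked in that very
scale. -/
theorem afterScale_active_disjoint_B (α : ℕ) (p : ℝ) (ω : Choices V) (k : ℕ) :
    Disjoint (afterScale G α p ω k).active (afterScale G α p ω k).B := by
  induction k with
  | zero => simp [afterScale]
  | succ k ih =>
    simp only [afterScale, markStep, afterIters_B]
    rw [Finset.disjoint_union_right]
    refine ⟨?_, Finset.sdiff_disjoint⟩
    exact ih.mono_left (Finset.sdiff_subset.trans (afterIters_active_subset G _ _ _ _))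

theorem sparse_afterScale (α : ℕ) (p : ℝ) (ω : Choices V) (k : ℕ) :
    Sparse G α (k + 1) (afterScale G α p ω k).active := by
  cases k with
  | zero => exact sparse_one G α _
  | succ k => exact sparse_markStep G α (k + 1) _

end Deterministic

/-! ### Resampling coordinates of a product measure -/

section Resample

/-- Replacing the coordinates in `S` by independent copies preserves a product measure. -/
theorem measurePreserving_piecewise {ι : Type*} (ν : Measure ℝ) [IsProbabilityMeasure ν]
    (S : Set ι) [DecidablePred (· ∈ S)] :
    MeasurePreserving (fun q : (ι → ℝ) × (ι → ℝ) => S.piecewise q.2 q.1)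
      ((Measure.infinitePi fun _ : ι => ν).prod (Measure.infinitePi fun _ : ι => ν))
      (Measure.infinitePi fun _ : ι => ν) := by
  have hm : Measurable (fun q : (ι → ℝ) × (ι → ℝ) => S.piecewise q.2 q.1) := by
    refine measurable_pi_lambda _ fun c => ?_
    by_cases hc : c ∈ S
    · simp only [Set.piecewise_eq_of_mem _ _ _ hc]; fun_prop
    · simp only [Set.piecewise_eq_of_notMem _ _ _ hc]; fun_prop
  refine ⟨hm, Measure.eq_infinitePi (μ := fun _ : ι => ν) fun s t ht => ?_⟩
  rw [Measure.map_apply hm (MeasurableSet.pi s.countable_toSet fun i _ => ht i)]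
  have : (fun q : (ι → ℝ) × (ι → ℝ) => S.piecewise q.2 q.1) ⁻¹' (Set.pi s t)
      = (Set.pi (s.filter (· ∉ S)) t) ×ˢ (Set.pi (s.filter (· ∈ S)) t) := by
    ext ⟨a, b⟩
    simp only [Set.mem_preimage, Set.mem_pi, Finset.mem_coe, Set.mem_prod, Finset.mem_filter]
    constructor
    · intro h
      refine ⟨fun i hi => ?_, fun i hi => ?_⟩
      · simpa [Set.piecewise_eq_of_notMem _ _ _ hi.2] using h i hi.1
      · simpa [Set.piecewise_eq_of_mem _ _ _ hi.2] using h i hi.1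
    · rintro ⟨h1, h2⟩ i hi
      by_cases hS : i ∈ S
      · simpa [Set.piecewise_eq_of_mem _ _ _ hS] using h2 i ⟨hi, hS⟩
      · simpa [Set.piecewise_eq_of_notMem _ _ _ hS] using h1 i ⟨hi, hS⟩
  rw [this, Measure.prod_prod, Measure.infinitePi_pi _ fun i _ => ht i,
    Measure.infinitePi_pi _ fun i _ => ht i, mul_comm, Finset.prod_filter_mul_prod_filter_not]

/-- Stands in for conditional expectation given the coordinates outside `S`. It is applied with `S`
the choices of one iteration, and with `S` the choices near `v` in one scale. -/
theorem lintegral_piecewise {ι : Type*} (ν : Measure ℝ) [IsProbabilityMeasure ν]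
    (S : Set ι) [DecidablePred (· ∈ S)] {f : (ι → ℝ) → ENNReal} (hf : Measurable f) :
    ∫⁻ ω, f ω ∂(Measure.infinitePi fun _ : ι => ν)
      = ∫⁻ ω₀, ∫⁻ ω, f (S.piecewise ω ω₀) ∂(Measure.infinitePi fun _ : ι => ν)
          ∂(Measure.infinitePi fun _ : ι => ν) := by
  have h := measurePreserving_piecewise ν S
  rw [← h.lintegral_comp hf]
  exact lintegral_prod _ (hf.comp h.measurable).aemeasurable

end Resample

/-! ### Tail bounds and two-phase exposure -/

section Tail

open ProbabilityTheory Real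

variable {V : Type*} {Ω : Type*} [MeasurableSpace Ω] {P : Measure Ω} [IsProbabilityMeasure P]
  {y : V → Ω → ℝ} {t τ : ℝ}

/-- The chord of the convex function exp over [0, 1] has slope e - 1 < 7/4. -/
theorem exp_le_one_add_mul {a : ℝ} (h0 : 0 ≤ a) (h1 : a ≤ 1) : exp a ≤ 1 + 7 / 4 * a := by
  have h := convexOn_exp.2 (Set.mem_univ 0) (Set.mem_univ 1) (sub_nonneg.2 h1) h0 (by ring)
  simp only [smul_eq_mul, mul_zero, mul_one, zero_add, Real.exp_zero] at h
  have := Real.exp_one_lt_d9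
  nlinarith

/-- Chernoff bound for a weighted number of values above a threshold. -/
theorem measureReal_weighted_tall_ge_le (hy : iIndepFun y P) (hm : ∀ z, Measurable (y z))
    (hτ : ∀ z, P.real {ω | t < y z ω} = τ) (Z : Finset V) {c : V → ℝ} {ρ : ℝ} (hρ : 0 < ρ)
    (hc0 : ∀ z ∈ Z, 0 ≤ c z) (hc : ∀ z ∈ Z, c z ≤ ρ) (s : ℝ) :
    P.real {ω | s ≤ ∑ z ∈ Z, c z * (Set.Ioi t).indicator 1 (y z ω)}
      ≤ exp (7 / 4 * τ * (∑ z ∈ Z, c z) / ρ - s / ρ) := by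
  -- Dividing by `ρ` puts the weights in [0, 1], where the chord bound applies to the moment
  -- generating function at 1.
  let X : V → Ω → ℝ := fun z ω => c z / ρ * (Set.Ioi t).indicator 1 (y z ω)
  have hgm : ∀ z, Measurable fun r : ℝ => c z / ρ * (Set.Ioi t).indicator (1 : ℝ → ℝ) r := fun z =>
    (measurable_const.indicator measurableSet_Ioi).const_mul _
  have hXi : iIndepFun X P :=
    hy.comp (fun z r => c z / ρ * (Set.Ioi t).indicator 1 r) hgm
  have hXm : ∀ z, Measurable (X z) := fun z => (hgm z).comp (hm z)
  have hE : ∀ z, MeasurableSet {ω | t < y z ω} := fun z => measurableSet_lt measurable_const (hm z)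
  have hexp : ∀ z ω, exp (1 * X z ω)
      = 1 + {ω | t < y z ω}.indicator (fun _ => exp (c z / ρ) - 1) ω := by
    intro z ω
    by_cases h : t < y z ω <;> simp [X, Set.indicator, h]
  have hmgf : ∀ z ∈ Z, mgf (X z) P 1 ≤ exp (7 / 4 * τ * (c z / ρ)) := by
    intro z hz
    have hi : Integrable ({ω | t < y z ω}.indicator (fun _ => exp (c z / ρ) - 1)) P :=
      (integrable_const _).indicator (hE z)
    have : mgf (X z) P 1 = 1 + τ * (exp (c z / ρ) - 1) := by
      rw [mgf]
      simp_rw [hexp]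
      rw [integral_add (integrable_const _) hi, integral_indicator_const _ (hE z), hτ]
      simp
    rw [this]
    have h1 := exp_le_one_add_mul (div_nonneg (hc0 z hz) hρ.le) ((div_le_one hρ).2 (hc z hz))
    have h2 : 0 ≤ τ := by rw [← hτ z]; exact measureReal_nonneg
    refine le_trans ?_ (add_one_le_exp _)
    nlinarith
  have hsum : {ω | s ≤ ∑ z ∈ Z, c z * (Set.Ioi t).indicator 1 (y z ω)}
      = {ω | s / ρ ≤ (∑ z ∈ Z, X z) ω} := by
    ext ω
    simp only [Set.mem_ofPred_eq, Finset.sum_apply, X]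
    rw [div_le_iff₀ hρ, Finset.sum_mul]
    have : ∀ z ∈ Z, c z / ρ * (Set.Ioi t).indicator 1 (y z ω) * ρ
        = c z * (Set.Ioi t).indicator 1 (y z ω) := fun z _ => by field_simp
    rw [Finset.sum_congr rfl this]
  have hint : Integrable (fun ω => exp (1 * (∑ z ∈ Z, X z) ω)) P := by
    apply hXi.integrable_exp_mul_sum hXm
    intro z _
    simp_rw [hexp]
    exact (integrable_const _).add ((integrable_const _).indicator (hE z))
  rw [hsum]
  refine (measure_ge_le_exp_mul_mgf (s / ρ) zero_le_one hint).trans ?_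
  rw [hXi.mgf_sum hXm, sub_eq_neg_add, exp_add]
  refine mul_le_mul (by simp) ?_ (Finset.prod_nonneg fun _ _ => mgf_nonneg) (exp_pos _).le
  refine (Finset.prod_le_prod (fun _ _ => mgf_nonneg) hmgf).trans ?_
  rw [← exp_sum, ← Finset.mul_sum, ← Finset.sum_div, mul_div_assoc]

theorem measureReal_forall_not_tall (hy : iIndepFun y P) (hm : ∀ z, Measurable (y z))
    (hτ : ∀ z, P.real {ω | t < y z ω} = τ) (T : Finset V) :
    P.real {ω | ∀ u ∈ T, y u ω ≤ t} = (1 - τ) ^ T.card := by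
  have h1 : ∀ u, P.real {ω | y u ω ≤ t} = 1 - τ := by
    intro u
    have := probReal_compl_eq_one_sub (μ := P) (measurableSet_lt measurable_const (hm u) :
      MeasurableSet {ω | t < y u ω})
    rw [hτ] at this
    rw [← this]
    congr 1
    ext ω
    simp
  have h2 : {ω | ∀ u ∈ T, y u ω ≤ t} = ⋂ u ∈ T, {ω | y u ω ≤ t} := by
    ext ω; simp
  rw [h2, measureReal_def, hy.meas_biInter (s := fun u => {ω | y u ω ≤ t})
      fun u _ => ⟨Set.Iic t, measurableSet_Iic, rfl⟩,
    ENNReal.toReal_prod]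
  simp_rw [← measureReal_def, h1]
  simp

/-- The number of groups, among those in `H`, that contain an element of `T` whose value is above
the threshold. -/
noncomputable def tallGroups {W : Type*} (H : Finset W) (T : Finset V) (g : V → W) (Y : Finset V) :
    Finset W :=
  open Classical in {w ∈ H | ∃ u ∈ T, g u = w ∧ u ∈ Y}

theorem mem_tallGroups {W : Type*} {H : Finset W} {T : Finset V} {g : V → W} {Y : Finset V}
    {w : W} : w ∈ tallGroups H T g Y ↔ w ∈ H ∧ ∃ u ∈ T, g u = w ∧ u ∈ Y := by
  simp [tallGroups]

/-- From (1 - τ²)^a ≤ 1 and Bernoulli, (1 - τ)^a ≤ 1/(1 + aτ). Replacing `a` by `m` in the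
denominator of the deficit makes the bound linear in `a`, so that it can be summed over groups. -/
theorem one_sub_pow_le {τ : ℝ} (h0 : 0 ≤ τ) (h1 : τ ≤ 1) {a m : ℕ} (ham : a ≤ m) :
    (1 - τ) ^ a ≤ 1 - a * τ / (1 + m * τ) := by
  have ha : (0 : ℝ) ≤ a := by positivity
  have ham' : (a : ℝ) ≤ m := by exact_mod_cast ham
  have hb : 1 + a * τ ≤ (1 + τ) ^ a := one_add_mul_le_pow (by linarith) a
  have hc : (1 + τ) ^ a * (1 - τ) ^ a ≤ 1 := by
    rw [← mul_pow]
    exact pow_le_one₀ (by nlinarith) (by nlinarith)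
  have hd : 0 ≤ (1 - τ) ^ a := pow_nonneg (by linarith) a
  have he : (1 - τ) ^ a * (1 + a * τ) ≤ 1 := by nlinarith
  have hpos : 0 < 1 + a * τ := by positivity
  have h2 : (1 - τ) ^ a ≤ 1 - a * τ / (1 + a * τ) := by
    rw [one_sub_div hpos.ne', le_div_iff₀ hpos]
    linarith
  refine h2.trans (sub_le_sub_left ?_ 1)
  gcongr

/-- Lower tail bound for the number of groups that contain a value above the threshold. -/
theorem measureReal_tallGroups_le {W : Type*} [DecidableEq W] (hy : iIndepFun y P)
    (hm : ∀ z, Measurable (y z))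
    (hτ : ∀ z, P.real {ω | t < y z ω} = τ) (hτ1 : τ ≤ 1) (H : Finset W) (T : Finset V)
    (g : V → W) (hg : ∀ u ∈ T, g u ∈ H) {m : ℕ}
    (hmc : ∀ w ∈ H, (T.filter fun u => g u = w).card ≤ m) (Y : Ω → Finset V)
    (hY : ∀ ω, ∀ u ∈ T, u ∈ Y ω ↔ t < y u ω) (r : ℝ) :
    P.real {ω | ((tallGroups H T g (Y ω)).card : ℝ) ≤ r}
      ≤ exp (r * log 2 - T.card * τ / (2 * (1 + m * τ))) := by
  classical
  -- `hτ` forces τ ≥ 0 only if there is a vertex.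
  rcases isEmpty_or_nonempty V with hV | ⟨⟨v₀⟩⟩
  · have hT : T = ∅ := Finset.eq_empty_of_isEmpty T
    subst hT
    rcases le_or_gt 0 r with hr | hr
    · refine measureReal_le_one.trans ?_
      rw [one_le_exp_iff]
      simp only [Finset.card_empty, Nat.cast_zero, zero_mul, zero_div, sub_zero]
      exact mul_nonneg hr (log_nonneg (by norm_num))
    · have : {ω | ((tallGroups H (∅ : Finset V) g (Y ω)).card : ℝ) ≤ r} = ∅ := by
        ext ω
        simp only [Set.mem_ofPred_eq, Set.mem_empty_iff_false, iff_false, not_le]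
        exact hr.trans_le (by positivity)
      rw [this]; simpa using (exp_pos _).le
  have hτ0 : 0 ≤ τ := by rw [← hτ v₀]; exact measureReal_nonneg
  let a : W → ℕ := fun w => (T.filter fun u => g u = w).card
  let N : W → Set Ω := fun w => {ω | ∀ u ∈ T, g u = w → y u ω ≤ t}
  have hNm : ∀ J : Finset W, MeasurableSet {ω | ∀ u ∈ T.filter (fun u => g u ∈ J), y u ω ≤ t} := by
    intro J
    have : {ω | ∀ u ∈ T.filter (fun u => g u ∈ J), y u ω ≤ t}
        = ⋂ u ∈ T.filter (fun u => g u ∈ J), {ω | y u ω ≤ t} := by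
      ext ω; simp
    rw [this]
    exact Finset.measurableSet_biInter _ fun u _ => measurableSet_le (hm u) measurable_const
  -- Chernoff's method with 2^(-N), N the number of hit groups. Expanding the product over subsets
  -- of `H` turns each term into the event that all members of the chosen groups are not tall, whose
  -- probability is a power of 1 - τ.
  have hpow : ∀ ω, (1 / 2 : ℝ) ^ (tallGroups H T g (Y ω)).card
      = ∏ w ∈ H, ((N w).indicator (fun _ => (1 / 2 : ℝ)) ω + 1 / 2) := by
    intro ω
    have h1 : ∀ w ∈ H, (N w).indicator (fun _ => (1 / 2 : ℝ)) ω + 1 / 2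
        = if ∃ u ∈ T, g u = w ∧ u ∈ Y ω then 1 / 2 else 1 := by
      intro w _
      by_cases h : ∃ u ∈ T, g u = w ∧ u ∈ Y ω
      · rw [if_pos h, Set.indicator_of_notMem, zero_add]
        obtain ⟨u, hu, hgu, huY⟩ := h
        intro hN
        exact absurd (hN u hu hgu) (not_le.2 ((hY ω u hu).1 huY))
      · rw [if_neg h, Set.indicator_of_mem]
        · norm_num
        · intro u hu hgu
          by_contra hlt
          exact h ⟨u, hu, hgu, (hY ω u hu).2 (not_le.1 hlt)⟩
    rw [Finset.prod_congr rfl h1, Finset.prod_ite, Finset.prod_const_one, mul_one,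
      Finset.prod_const]
    congr 2
    unfold tallGroups
    congr!
  have hterm : ∀ (J : Finset W) (ω : Ω), ∏ w ∈ J, (N w).indicator (fun _ => (1 / 2 : ℝ)) ω
      = {ω | ∀ u ∈ T.filter (fun u => g u ∈ J), y u ω ≤ t}.indicator
          (fun _ => (1 / 2 : ℝ) ^ J.card) ω := by
    intro J ω
    by_cases h : ∀ w ∈ J, ω ∈ N w
    · rw [Finset.prod_congr rfl fun w hw => Set.indicator_of_mem (h w hw) _,
        Set.indicator_of_mem, Finset.prod_const]
      intro u hu
      have := Finset.mem_filter.1 hu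
      exact h _ this.2 u this.1 rfl
    · push Not at h
      obtain ⟨w, hw, hN⟩ := h
      rw [Finset.prod_eq_zero hw (Set.indicator_of_notMem hN _), Set.indicator_of_notMem]
      intro h'
      exact hN fun u hu hgu => h' u (Finset.mem_filter.2 ⟨hu, hgu ▸ hw⟩)
  have hcard : ∀ J ⊆ H, (T.filter fun u => g u ∈ J).card = ∑ w ∈ J, a w := by
    intro J _
    have hmaps : Set.MapsTo g (T.filter fun u => g u ∈ J : Finset V) J :=
      fun u hu => (Finset.mem_filter.1 (Finset.mem_coe.1 hu)).2
    rw [Finset.card_eq_sum_card_fiberwise hmaps]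
    refine Finset.sum_congr rfl fun w hw => ?_
    congr 1
    ext u
    simp only [Finset.mem_filter]
    constructor
    · rintro ⟨⟨h1, -⟩, h2⟩; exact ⟨h1, h2⟩
    · rintro ⟨h1, h2⟩; exact ⟨⟨h1, h2 ▸ hw⟩, h2⟩
  have hint : ∫ ω, (1 / 2 : ℝ) ^ (tallGroups H T g (Y ω)).card ∂P
      = ∏ w ∈ H, (1 / 2 * (1 - τ) ^ a w + 1 / 2) := by
    simp_rw [hpow, Finset.prod_add, hterm]
    rw [integral_finsetSum]
    · refine Finset.sum_congr rfl fun J hJ => ?_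
      rw [integral_mul_const, integral_indicator_const _ (hNm J),
        measureReal_forall_not_tall hy hm hτ, hcard J (Finset.mem_powerset.1 hJ),
        Finset.prod_mul_distrib, Finset.prod_const, Finset.prod_const, Finset.prod_pow_eq_pow_sum,
        smul_eq_mul]
      ring
    · intro J _
      exact ((integrable_const _).indicator (hNm J)).mul_const _
  have hbound : ∏ w ∈ H, (1 / 2 * (1 - τ) ^ a w + 1 / 2)
      ≤ exp (-(T.card * τ / (2 * (1 + m * τ)))) := by
    have h1 : ∀ w ∈ H, 1 / 2 * (1 - τ) ^ a w + 1 / 2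
        ≤ exp (-(a w * (τ / (2 * (1 + m * τ))))) := by
      intro w hw
      have := one_sub_pow_le hτ0 hτ1 (hmc w hw)
      refine le_trans ?_ (add_one_le_exp _)
      have h3 : (a w : ℝ) * (τ / (2 * (1 + m * τ))) = 1 / 2 * (a w * τ / (1 + m * τ)) := by
        have : 1 + m * τ ≠ 0 := by positivity
        field_simp
      rw [h3]
      linarith
    refine (Finset.prod_le_prod (fun w _ => ?_) h1).trans ?_
    · have := pow_nonneg (sub_nonneg.2 hτ1) (a w)
      linarith
    · rw [← exp_sum, Finset.sum_neg_distrib, ← Finset.sum_mul]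
      have : (T.card : ℝ) = ∑ w ∈ H, (a w : ℝ) := by
        rw [← Nat.cast_sum, ← hcard H subset_rfl, Finset.filter_true_of_mem hg]
      rw [this, mul_div_assoc]
  have hintg : Integrable (fun ω => (1 / 2 : ℝ) ^ (tallGroups H T g (Y ω)).card) P := by
    simp_rw [hpow, Finset.prod_add, hterm]
    exact integrable_finsetSum _ fun J _ => ((integrable_const _).indicator (hNm J)).mul_const _
  have hmarkov := mul_meas_ge_le_integral_of_nonneg (μ := P)
    (Filter.Eventually.of_forall fun ω => by positivity) hintg (exp (-(r * log 2)))
  have hsub : {ω | ((tallGroups H T g (Y ω)).card : ℝ) ≤ r}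
      ⊆ {ω | exp (-(r * log 2)) ≤ (1 / 2 : ℝ) ^ (tallGroups H T g (Y ω)).card} := by
    intro ω hω
    simp only [Set.mem_ofPred_eq] at hω ⊢
    have h2 : (1 / 2 : ℝ) ^ (tallGroups H T g (Y ω)).card
        = exp (-((tallGroups H T g (Y ω)).card * log 2)) := by
      rw [exp_neg, mul_comm, exp_mul, exp_log (by norm_num), rpow_natCast, one_div, inv_pow]
    rw [h2, exp_le_exp, neg_le_neg_iff]
    exact mul_le_mul_of_nonneg_right hω (log_nonneg (by norm_num))
  have h3 : exp (-(r * log 2)) * P.real {ω | ((tallGroups H T g (Y ω)).card : ℝ) ≤ r}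
      ≤ exp (-(T.card * τ / (2 * (1 + m * τ)))) :=
    (mul_le_mul_of_nonneg_left (measureReal_mono hsub) (exp_pos _).le).trans
      (hmarkov.trans (hint.le.trans hbound))
  rw [sub_eq_add_neg, exp_add]
  have h4 : exp (r * log 2) * exp (-(r * log 2)) = 1 := by rw [← exp_add]; simp
  calc P.real {ω | ((tallGroups H T g (Y ω)).card : ℝ) ≤ r}
      = exp (r * log 2) * (exp (-(r * log 2)) *
          P.real {ω | ((tallGroups H T g (Y ω)).card : ℝ) ≤ r}) := by rw [← mul_assoc, h4, one_mul]
    _ ≤ _ := mul_le_mul_of_nonneg_left h3 (exp_pos _).le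

/-- Exposing first the coordinates in `Z`, then those in `Q`: if for every good outcome of the
former the conditional probability of `R` is at most `ε`, so is the probability that the
outcome is good and `R` occurs. -/
theorem measure_two_phase_le (hy : iIndepFun y P) (hm : ∀ z, Measurable (y z)) {Z Q : Finset V}
    (hZQ : Disjoint Z Q) (good : Finset V → Prop) (R : Finset V → Finset V → Prop) {ε : ENNReal}
    (h : ∀ S ⊆ Z, good S → P {ω | R S (open Classical in {u ∈ Q | t < y u ω})} ≤ ε) :
    P {ω | good (open Classical in {z ∈ Z | t < y z ω}) ∧
      R (open Classical in {z ∈ Z | t < y z ω}) (open Classical in {u ∈ Q | t < y u ω})} ≤ ε := by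
  classical
  -- Passing to Booleans makes the exposed outcomes finite in number, so `good` and `R` need no
  -- measurability.
  let b : V → Ω → Bool := fun z ω => decide (t < y z ω)
  have hdm : Measurable fun r : ℝ => decide (t < r) := by
    refine measurable_to_bool ?_
    have : (fun r : ℝ => decide (t < r)) ⁻¹' {true} = Set.Ioi t := by ext; simp
    rw [this]; exact measurableSet_Ioi
  have hbi : iIndepFun b P := hy.comp (fun _ r => decide (t < r)) fun _ => hdm
  have hbm : ∀ z, Measurable (b z) := fun z => hdm.comp (hm z)
  have hind := hbi.indepFun_finset Z Q hZQ hbm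
  let F : (S : Finset V) → (S → Bool) → Finset V := fun S f =>
    S.filter fun u => ∃ h : u ∈ S, f ⟨u, h⟩ = true
  have hF : ∀ (S : Finset V) ω, S.filter (fun u => t < y u ω) = F S fun i => b i ω := by
    intro S ω
    ext u
    simp only [F, b, Finset.mem_filter, decide_eq_true_eq]
    constructor
    · rintro ⟨h1, h2⟩; exact ⟨h1, h1, h2⟩
    · rintro ⟨h1, -, h2⟩; exact ⟨h1, h2⟩
  have hmul : ∀ S : Finset V,
      P ({ω | Z.filter (fun u => t < y u ω) = S} ∩ {ω | R S (Q.filter fun u => t < y u ω)})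
      = P {ω | Z.filter (fun u => t < y u ω) = S} * P {ω | R S (Q.filter fun u => t < y u ω)} := by
    intro S
    have := hind.measure_inter_preimage_eq_mul {f | F Z f = S} {f | R S (F Q f)}
      (Set.toFinite _).measurableSet (Set.toFinite _).measurableSet
    simpa only [Set.preimage_ofPred_eq, ← hF] using this
  have hms : ∀ S : Finset V, MeasurableSet {ω | Z.filter (fun u => t < y u ω) = S} := by
    intro S
    have h1 : Measurable fun ω (i : Z) => b i ω := measurable_pi_lambda _ fun i => hbm i
    have := h1 (Set.toFinite {f | F Z f = S}).measurableSet
    simpa only [Set.preimage_ofPred_eq, ← hF] using this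
  have hsub : {ω | good (Z.filter fun u => t < y u ω) ∧
        R (Z.filter fun u => t < y u ω) (Q.filter fun u => t < y u ω)}
      ⊆ ⋃ S ∈ Z.powerset.filter good,
        ({ω | Z.filter (fun u => t < y u ω) = S} ∩ {ω | R S (Q.filter fun u => t < y u ω)}) := by
    intro ω hω
    simp only [Set.mem_iUnion]
    exact ⟨_, Finset.mem_filter.2 ⟨Finset.mem_powerset.2 (Finset.filter_subset _ _), hω.1⟩,
      rfl, hω.2⟩
  refine (measure_mono hsub).trans ((measure_biUnion_finset_le _ _).trans ?_)
  calc ∑ S ∈ Z.powerset.filter good,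
        P ({ω | Z.filter (fun u => t < y u ω) = S} ∩ {ω | R S (Q.filter fun u => t < y u ω)})
      ≤ ∑ S ∈ Z.powerset.filter good, P {ω | Z.filter (fun u => t < y u ω) = S} * ε := by
        refine Finset.sum_le_sum fun S hS => ?_
        rw [hmul]
        have := Finset.mem_filter.1 hS
        gcongr
        exact h S (Finset.mem_powerset.1 this.1) this.2
    _ = P (⋃ S ∈ Z.powerset.filter good, {ω | Z.filter (fun u => t < y u ω) = S}) * ε := by
        rw [← Finset.sum_mul, measure_biUnion_finset]
        · intro S _ S' _ hne
          rw [Function.onFun, Set.disjoint_left]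
          intro ω h1 h2
          exact hne (h1.symm.trans h2)
        · exact fun S _ => hms S
    _ ≤ 1 * ε := by gcongr; exact prob_le_one
    _ = ε := one_mul _

end Tail

/-! ### One iteration: survivors of the first exposure -/

section OneStep

open ProbabilityTheory Real

variable {V : Type*} [Fintype V] [DecidableEq V] (G : SimpleGraph V) [DecidableRel G.Adj]
  {Ω : Type*} [MeasurableSpace Ω] {P : Measure Ω} [IsProbabilityMeasure P]
  {y : V → Ω → ℝ}

/-- In an iteration, all but at most half of an independent set `Q` of competitive nodes of low
degree survive the exposure of the values outside `Q`, and the survivors with a large value join. -/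
theorem exists_survivors (hy : iIndepFun y P) (hm : ∀ z, Measurable (y z)) {t τ : ℝ} (ht : 0 ≤ t)
    (hτ : ∀ z, P.real {ω | t < y z ω} = τ) {k : ℕ} {A Q : Finset V} {x : Ω → V → ℝ} {d : ℝ}
    (hQA : Q ⊆ A) (hQ : ∀ u ∈ Q, ∀ u' ∈ Q, ¬ G.Adj u u')
    (hd : ∀ u ∈ Q, (activeDeg G A u : ℝ) ≤ d) (hdρ : d ≤ rho G k) (hρ : 0 < rho G k)
    (hτ0 : 0 ≤ τ)
    (hxy : ∀ u ∈ Q, ∀ z, z = u ∨ G.Adj u z → ∀ ω, x ω z = y z ω)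
    (R : Finset V → Finset V → Prop) {ε : ENNReal}
    (hR : ∀ T ⊆ Q, Q.card ≤ 2 * T.card →
      P {ω | R T (open Classical in {u ∈ Q | t < y u ω})} ≤ ε) :
    ∃ T : Ω → Finset V, (∀ ω, T ω ⊆ Q) ∧
      (∀ ω, ∀ u ∈ T ω, t < y u ω → u ∈ joining G k A (x ω)) ∧
      P {ω | R (T ω) (open Classical in {u ∈ Q | t < y u ω})}
        ≤ ε + ENNReal.ofReal (exp (-(Q.card / rho G k * (1 / 2 - 7 / 4 * (τ * d))))) := by
  classical
  -- Only competitive neighbors can stop a node of `Q` from joining. They lie outside `Q` because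
  -- `Q` is independent.
  let Z : Finset V := {z ∈ A | (activeDeg G A z : ℝ) ≤ rho G k ∧ ∃ u ∈ Q, G.Adj u z}
  have hZQ : Disjoint Z Q := by
    rw [Finset.disjoint_left]
    intro z hz hzQ
    obtain ⟨u, hu, huz⟩ := (Finset.mem_filter.1 hz).2.2
    exact hQ u hu z hzQ huz
  let surv : Finset V → Finset V := fun S => {u ∈ Q | ∀ z ∈ S, ¬ G.Adj u z}
  -- The number of nodes of `Q` that a tall `z` blocks. It is at most ρ_k since `z` is competitive,
  -- and the degree bound `d` on `Q` bounds the total weight.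
  let c : V → ℝ := fun z => ((Q.filter fun u => G.Adj u z).card : ℝ)
  have hcle : ∀ z ∈ Z, c z ≤ rho G k := by
    intro z hz
    have hz' := Finset.mem_filter.1 hz
    refine le_trans ?_ hz'.2.1
    refine Nat.cast_le.2 (Finset.card_le_card fun u hu => ?_)
    have hu' := Finset.mem_filter.1 hu
    exact (mem_activeNbrs G).2 ⟨hQA hu'.1, hu'.2.symm⟩
  have hcsum : ∑ z ∈ Z, c z ≤ Q.card * d := by
    have h1 : ∑ z ∈ Z, c z = ∑ u ∈ Q, ((Z.filter fun z => G.Adj u z).card : ℝ) := by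
      simp only [c, Finset.card_filter, Nat.cast_sum]
      rw [Finset.sum_comm]
    rw [h1, ← nsmul_eq_mul]
    refine Finset.sum_le_card_nsmul _ _ _ fun u hu => le_trans ?_ (hd u hu)
    refine Nat.cast_le.2 (Finset.card_le_card fun z hz => ?_)
    have hz' := Finset.mem_filter.1 hz
    exact (mem_activeNbrs G).2 ⟨(Finset.mem_filter.1 hz'.1).1, hz'.2⟩
  let tz : Ω → Finset V := fun ω => {z ∈ Z | t < y z ω}
  let good : Finset V → Prop := fun S => Q.card ≤ 2 * (surv S).card
  have h2 := measure_two_phase_le hy hm (t := t) hZQ good (fun S Y => R (surv S) Y) (ε := ε)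
    fun S _ hS => hR (surv S) (Finset.filter_subset _ _) hS
  -- If fewer than half survive, the tall nodes of `Z` have total weight at least |Q|/2, whereas the
  -- expected weight is at most τ·d·|Q|.
  have hkill : P {ω | ¬ good (tz ω)}
      ≤ ENNReal.ofReal (exp (-(Q.card / rho G k * (1 / 2 - 7 / 4 * (τ * d))))) := by
    have h3 := measureReal_weighted_tall_ge_le hy hm hτ Z hρ (fun z _ => Nat.cast_nonneg _) hcle
      (Q.card / 2)
    have hsub : {ω | ¬ good (tz ω)}
        ⊆ {ω | (Q.card / 2 : ℝ) ≤ ∑ z ∈ Z, c z * (Set.Ioi t).indicator 1 (y z ω)} := by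
      intro ω hω
      simp only [Set.mem_ofPred_eq, good, not_le] at hω ⊢
      have e1 : ∑ z ∈ Z, c z * (Set.Ioi t).indicator 1 (y z ω) = ∑ z ∈ tz ω, c z := by
        simp only [tz, Finset.sum_filter]
        refine Finset.sum_congr rfl fun z _ => ?_
        by_cases h : t < y z ω <;> simp [Set.indicator, h]
      have e2 : Q.card ≤ (surv (tz ω)).card + ∑ z ∈ tz ω, (Q.filter fun u => G.Adj u z).card := by
        have : Q ⊆ surv (tz ω) ∪ (tz ω).biUnion fun z => Q.filter fun u => G.Adj u z := by
          intro u hu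
          by_cases h : ∀ z ∈ tz ω, ¬ G.Adj u z
          · exact Finset.mem_union_left _ (Finset.mem_filter.2 ⟨hu, h⟩)
          · push Not at h
            obtain ⟨z, hz, huz⟩ := h
            exact Finset.mem_union_right _
              (Finset.mem_biUnion.2 ⟨z, hz, Finset.mem_filter.2 ⟨hu, huz⟩⟩)
        exact (Finset.card_le_card this).trans
          ((Finset.card_union_le _ _).trans (Nat.add_le_add_left Finset.card_biUnion_le _))
      rw [e1]
      have e3 : (∑ z ∈ tz ω, c z) = ((∑ z ∈ tz ω, (Q.filter fun u => G.Adj u z).card : ℕ) : ℝ) := by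
        simp [c]
      rw [e3]
      have e4 : Q.card ≤ 2 * ∑ z ∈ tz ω, (Q.filter fun u => G.Adj u z).card := by omega
      have e5 : (Q.card : ℝ) ≤ 2 * ((∑ z ∈ tz ω, (Q.filter fun u => G.Adj u z).card : ℕ) : ℝ) := by
        exact_mod_cast e4
      linarith
    rw [← ofReal_measureReal]
    refine ENNReal.ofReal_le_ofReal ((measureReal_mono hsub).trans (h3.trans (exp_le_exp.2 ?_)))
    have h4 : 7 / 4 * τ * (∑ z ∈ Z, c z) / rho G k ≤ 7 / 4 * τ * (Q.card * d) / rho G k := by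
      gcongr
    refine (sub_le_sub_right h4 _).trans (le_of_eq ?_)
    field_simp
    ring
  refine ⟨fun ω => surv (tz ω), fun ω => Finset.filter_subset _ _, fun ω u hu htu => ?_, ?_⟩
  · have hu' := Finset.mem_filter.1 hu
    refine mem_joining_of_tall G ht (hQA hu'.1) ((hd u hu'.1).trans hdρ) ?_ fun z hz hzρ => ?_
    · rw [hxy u hu'.1 u (Or.inl rfl)]; exact htu
    · have hz' := (mem_activeNbrs G).1 hz
      rw [hxy u hu'.1 z (Or.inr hz'.2)]
      by_contra hlt
      exact hu'.2 z (Finset.mem_filter.2 ⟨Finset.mem_filter.2 ⟨hz'.1, hzρ, u, hu'.1, hz'.2⟩,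
        not_le.1 hlt⟩) hz'.2
  · refine le_trans (measure_mono ?_) ((measure_union_le _ _).trans (add_le_add h2 hkill))
    intro ω hω
    by_cases hg : good (tz ω)
    · exact Or.inl ⟨hg, hω⟩
    · exact Or.inr hg

end OneStep

/-! ### One iteration: progress for a fixed node -/

section OneStep

open ProbabilityTheory Real

variable {V : Type*} [Fintype V] [DecidableEq V] (G : SimpleGraph V) [DecidableRel G.Adj]
  {Ω : Type*} [MeasurableSpace Ω] {P : Measure Ω} [IsProbabilityMeasure P]
  {y : V → Ω → ℝ}

theorem rho_eq (k : ℕ) : rho G k = 4 * (maxDeg G / 2 ^ k) * log (maxDeg G) := by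
  rw [rho, pow_succ]; field_simp; ring

/-- The source of the radius 3: `w` is a high-degree neighbor of `v`, `u` its child (or `w` itself),
and `z` a competitor of `u`. -/
theorem edist_le_three {v w u z : V} (hw : G.Adj v w) (hu : w = u ∨ G.Adj w u)
    (hz : z = u ∨ G.Adj u z) : G.edist v z ≤ 3 := by
  have h1 : G.edist v w = 1 := SimpleGraph.edist_eq_one_iff_adj.2 hw
  have h2 : G.edist w u ≤ 1 := by
    rcases hu with rfl | hu
    · simp
    · exact (SimpleGraph.edist_eq_one_iff_adj.2 hu).le
  have h3 : G.edist u z ≤ 1 := by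
    rcases hz with rfl | hz
    · simp
    · exact (SimpleGraph.edist_eq_one_iff_adj.2 hz).le
  calc G.edist v z ≤ G.edist v w + G.edist w z := G.edist_triangle
    _ ≤ G.edist v w + (G.edist w u + G.edist u z) := by gcongr; exact G.edist_triangle
    _ ≤ 1 + (1 + 1) := by rw [h1]; gcongr
    _ = 3 := by norm_num

theorem mem_highDegNbrs {α k : ℕ} {A : Finset V} {v w : V} :
    w ∈ highDegNbrs G α k A v ↔
      (w ∈ A ∧ G.Adj v w) ∧ maxDeg G / 2 ^ k + α < (activeDeg G A w : ℝ) := by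
  simp [highDegNbrs, mem_activeNbrs]

/-- A high-degree neighbor has many low-degree children. -/
theorem card_lowDeg_children {α k : ℕ} {A : Finset V} (hA : Sparse G α k A) {par : V → Finset V}
    (hpar : ∀ v, (par v).card ≤ α) (hG : ∀ u v, G.Adj u v → v ∈ par u ∨ u ∈ par v) {w : V}
    (hw : w ∈ A) (hdeg : maxDeg G / 2 ^ k + α < (activeDeg G A w : ℝ)) :
    maxDeg G / 2 ^ k / 2 ≤ (({u ∈ activeNbrs G A w | w ∈ par u ∧
      (activeDeg G A u : ℝ) ≤ 2 * (maxDeg G / 2 ^ k) + α} : Finset V).card : ℝ) := by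
  classical
  set C := ({u ∈ activeNbrs G A w | w ∈ par u ∧
      (activeDeg G A u : ℝ) ≤ 2 * (maxDeg G / 2 ^ k) + α} : Finset V) with hC
  -- Of the more than D + α neighbors, at most α are parents and, by `Sparse` at `w`, at most D/2
  -- have too large a degree.
  have hsub : activeNbrs G A w ⊆ par w ∪ (({u ∈ activeNbrs G A w |
      (activeDeg G A u : ℝ) > 2 * (maxDeg G / 2 ^ k) + α} : Finset V) ∪ C) := by
    intro u hu
    rcases hG w u ((mem_activeNbrs G).1 hu).2 with h | h
    · exact Finset.mem_union_left _ h
    · refine Finset.mem_union_right _ ?_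
      by_cases hl : (activeDeg G A u : ℝ) ≤ 2 * (maxDeg G / 2 ^ k) + α
      · exact Finset.mem_union_right _ (Finset.mem_filter.2 ⟨hu, h, hl⟩)
      · exact Finset.mem_union_left _ (Finset.mem_filter.2 ⟨hu, not_le.1 hl⟩)
  have h1 := (Finset.card_le_card hsub).trans ((Finset.card_union_le _ _).trans
    (Nat.add_le_add (hpar w) (Finset.card_union_le _ _)))
  have h2 := hA w hw
  have h3 : (activeDeg G A w : ℝ) ≤ α + (({u ∈ activeNbrs G A w |
      (activeDeg G A u : ℝ) > 2 * (maxDeg G / 2 ^ k) + α} : Finset V).card + C.card) := by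
    exact_mod_cast h1
  linarith

/-- There are many distinct low-degree children of the high-degree neighbors, grouped so that no
group is large. -/
theorem exists_grouped_children {α : ℕ} {par : V → Finset V}
    (hpar : ∀ v, (par v).card ≤ α) (H : Finset V) (C : V → Finset V) {m : ℕ}
    (hC : ∀ w ∈ H, m ≤ (C w).card) (hCp : ∀ w ∈ H, ∀ u ∈ C w, w ∈ par u) :
    ∃ (U : Finset V) (g : V → V), (∀ u ∈ U, g u ∈ H ∧ u ∈ C (g u)) ∧
      H.card * m ≤ α * U.card ∧
      ∀ w ∈ H, ∀ T ⊆ U, (T.filter fun u => g u = w).card ≤ m := by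
  classical
  -- Trimming all child sets to size `m` caps the groups, as the lower-tail bound requires. Each
  -- child is then assigned to one of its at most α parents, hence the factor `α` in the count.
  have hch : ∀ w, ∃ C' ⊆ C w, w ∈ H → C'.card = m := by
    intro w
    by_cases hw : w ∈ H
    · obtain ⟨C', h1, h2⟩ := Finset.exists_subset_card_eq (hC w hw)
      exact ⟨C', h1, fun _ => h2⟩
    · exact ⟨∅, by simp, fun h => absurd h hw⟩
  choose C' hC'C hC'm using hch
  let U := H.biUnion C'
  have hgch : ∀ u, ∃ w, u ∈ U → w ∈ H ∧ u ∈ C' w := by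
    intro u
    by_cases hu : u ∈ U
    · obtain ⟨w, h1, h2⟩ := Finset.mem_biUnion.1 hu
      exact ⟨w, fun _ => ⟨h1, h2⟩⟩
    · exact ⟨u, fun h => absurd h hu⟩
  choose g hg using hgch
  refine ⟨U, g, fun u hu => ⟨(hg u hu).1, hC'C _ (hg u hu).2⟩, ?_, fun w hw T hT => ?_⟩
  · have h1 : ∑ w ∈ H, (C' w).card = ∑ u ∈ U, (H.filter fun w => u ∈ C' w).card := by
      have : ∀ w ∈ H, (C' w).card = (U.filter fun u => u ∈ C' w).card := by
        intro w hw
        congr 1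
        ext u
        simp only [Finset.mem_filter]
        exact ⟨fun h => ⟨Finset.mem_biUnion.2 ⟨w, hw, h⟩, h⟩, fun h => h.2⟩
      rw [Finset.sum_congr rfl this]
      simp only [Finset.card_filter]
      rw [Finset.sum_comm]
    rw [Finset.sum_congr rfl fun w hw => hC'm w hw, Finset.sum_const, smul_eq_mul] at h1
    rw [h1, mul_comm, ← smul_eq_mul]
    refine Finset.sum_le_card_nsmul _ _ _ fun u _ => le_trans (Finset.card_le_card ?_) (hpar u)
    intro w hw
    have := Finset.mem_filter.1 hw
    exact hCp w this.1 u (hC'C w this.2)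
  · rw [← hC'm w hw]
    refine Finset.card_le_card fun u hu => ?_
    have := Finset.mem_filter.1 hu
    exact this.2 ▸ (hg u (hT this.1)).2

/-- Here `q` is |Q|, 4Dℓ is ρ_k and 1/4 is τ(2D + α). The last factor is 1/16, so q ≥ 64Dℓ²
suffices. -/
theorem kill_exponent_le {a ℓ D X q : ℝ} (ha : 1 ≤ a) (hℓ : 10 ≤ ℓ)
    (hD : 18816 * a ^ 10 * ℓ ^ 2 ≤ D) (hX : D / 4 < X) (hq : X * (D / 2) ≤ 3 * a ^ 2 * q) :
    ℓ ≤ q / (4 * D * ℓ) * (1 / 2 - 7 / 4 * (1 / 4)) := by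
  have hD0 : 0 < D := lt_of_lt_of_le (by positivity) hD
  have h1 : a ^ 2 ≤ a ^ 10 := pow_le_pow_right₀ ha (by norm_num)
  have hX' : 384 * a ^ 2 * ℓ ^ 2 ≤ X := by
    have : a ^ 2 * ℓ ^ 2 ≤ a ^ 10 * ℓ ^ 2 := by gcongr
    have : 0 ≤ a ^ 2 * ℓ ^ 2 := by positivity
    linarith
  have hq' : 64 * D * ℓ ^ 2 ≤ q := by
    have h2 : 384 * a ^ 2 * ℓ ^ 2 * (D / 2) ≤ 3 * a ^ 2 * q :=
      (mul_le_mul_of_nonneg_right hX' (by positivity)).trans hq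
    have h3 : 0 < 3 * a ^ 2 := by positivity
    refine le_of_mul_le_mul_left ?_ h3
    linarith
  rw [div_mul_eq_mul_div, le_div_iff₀ (by positivity)]
  linarith

/-- With Y = X/a², the subtracted term is at least Y/205 and the first at most 0.6932·Y/176. The
constant 176 exceeds 205·ln 2, so a positive multiple of Y ≥ 4704ℓ² is left. -/
theorem hit_exponent_le {a ℓ D X m T : ℝ} (ha : 1 ≤ a) (hℓ : 10 ≤ ℓ)
    (hD : 18816 * a ^ 10 * ℓ ^ 2 ≤ D) (hX : D / 4 < X) (hm : D / 2 ≤ m)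
    (hT : X * m ≤ 6 * a ^ 2 * T) :
    X / (176 * a ^ 2) * log 2 - T * (1 / (8 * D + 4 * a)) / (2 * (1 + m * (1 / (8 * D + 4 * a))))
      ≤ -ℓ := by
  have hD0 : 0 < D := lt_of_lt_of_le (by positivity) hD
  have hX0 : 0 < X := lt_trans (by positivity) hX
  have h1 : a ≤ a ^ 10 := le_self_pow₀ ha (by norm_num)
  have h2 : a ^ 2 ≤ a ^ 10 := pow_le_pow_right₀ ha (by norm_num)
  have hℓ2 : 100 ≤ ℓ ^ 2 := by nlinarith
  have haD : 4 * a ≤ D / 1000 := by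
    have : a * 100 ≤ a ^ 10 * ℓ ^ 2 := by gcongr
    linarith
  have hm0 : 0 < m := lt_of_lt_of_le (by positivity) hm
  set Y := X / a ^ 2 with hY
  have hXY : X = Y * a ^ 2 := by rw [hY]; field_simp
  have hYl : 4704 * ℓ ^ 2 ≤ Y := by
    rw [hY, le_div_iff₀ (by positivity)]
    have : a ^ 2 * ℓ ^ 2 ≤ a ^ 10 * ℓ ^ 2 := by gcongr
    linarith
  have hY0 : 0 < Y := by positivity
  have hT' : Y * m / 6 ≤ T := by
    have : 0 < a ^ 2 := by positivity
    rw [hXY] at hT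
    have : Y * m * a ^ 2 ≤ 6 * T * a ^ 2 := by linarith
    have := le_of_mul_le_mul_right this (by positivity)
    linarith
  have e1 : T * (1 / (8 * D + 4 * a)) / (2 * (1 + m * (1 / (8 * D + 4 * a))))
      = T / (2 * (8 * D + 4 * a + m)) := by
    have : 0 < 8 * D + 4 * a := by positivity
    field_simp
  have e2 : Y / 205 ≤ T / (2 * (8 * D + 4 * a + m)) := by
    rw [div_le_div_iff₀ (by norm_num) (by positivity)]
    have h3 : 8 * D + 4 * a + m ≤ 17.01 * m := by linarith
    have h4 : Y * (8 * D + 4 * a + m) ≤ Y * (17.01 * m) := by gcongr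
    have : 0 < Y * m := by positivity
    linarith
  have e3 : X / (176 * a ^ 2) * log 2 ≤ Y * (0.6932 / 176) := by
    have : X / (176 * a ^ 2) = Y / 176 := by rw [hY]; field_simp
    rw [this]
    have := log_two_lt_d9
    have : log 2 ≤ 0.6932 := by linarith
    calc Y / 176 * log 2 ≤ Y / 176 * 0.6932 := by gcongr
      _ = _ := by ring
  rw [e1]
  have : ℓ ≤ ℓ ^ 2 := by nlinarith
  linarith

/-- While `v` has more than `Δ / 2^(k+2)` high-degree neighbors, an iteration very likely
removes a constant fraction of them. -/
theorem measure_many_highDegNbrs_le (hy : iIndepFun y P) (hm : ∀ z, Measurable (y z))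
    (hu : ∀ z, ∀ s, 0 ≤ s → s ≤ 1 → P.real {ω | s < y z ω} = 1 - s)
    {α k : ℕ} {v : V} {A : Finset V} {x : Ω → V → ℝ}
    (hxy : ∀ z, G.edist v z ≤ 3 → ∀ ω, x ω z = y z ω)
    {par : V → Finset V}
    (hpar : ∀ v, (par v).card ≤ α) (hG : ∀ u v, G.Adj u v → v ∈ par u ∨ u ∈ par v)
    (hα : 1 ≤ α) (hℓ : 10 ≤ log (maxDeg G))
    (hD : 18816 * (α : ℝ) ^ 10 * log (maxDeg G) ^ 2 ≤ maxDeg G / 2 ^ k)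
    (hA : Sparse G α k A)
    (hX : maxDeg G / 2 ^ k / 4 < ((highDegNbrs G α k A v).card : ℝ)) :
    P {ω | (1 - 1 / (176 * (α : ℝ) ^ 2)) * (highDegNbrs G α k A v).card
        < ((highDegNbrs G α k (iterActive G k A (x ω)) v).card : ℝ)}
      ≤ ENNReal.ofReal (2 * exp (-log (maxDeg G))) := by
  classical
  set D := maxDeg G / 2 ^ k with hDdef
  set ℓ := log (maxDeg G) with hℓdef
  set H := highDegNbrs G α k A v with hH
  have ha : (1 : ℝ) ≤ α := by exact_mod_cast hα
  have hD0 : 0 < D := lt_of_lt_of_le (by positivity) hD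
  let C : V → Finset V := fun w => {u ∈ activeNbrs G A w | w ∈ par u ∧
      (activeDeg G A u : ℝ) ≤ 2 * D + α}
  have hCcard : ∀ w ∈ H, ⌈D / 2⌉₊ ≤ (C w).card := fun w hw =>
    Nat.ceil_le.2 (card_lowDeg_children G hA hpar hG ((mem_highDegNbrs G).1 hw).1.1
      ((mem_highDegNbrs G).1 hw).2)
  obtain ⟨U, g, hgU, hUc, hgm⟩ := exists_grouped_children hpar H C hCcard
    fun w _ u hu => (Finset.mem_filter.1 hu).2.1
  obtain ⟨Q, hQU, hQ, hQc⟩ := exists_independent_subset hpar hG U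
  set m := ⌈D / 2⌉₊
  have hmD : D / 2 ≤ m := Nat.le_ceil _
  have hprop : ∀ u ∈ Q, G.Adj v (g u) ∧ G.Adj (g u) u ∧ u ∈ A ∧
      (activeDeg G A u : ℝ) ≤ 2 * D + α := by
    intro u hu
    have h1 := hgU u (hQU hu)
    have h2 := Finset.mem_filter.1 h1.2
    have h3 := (mem_activeNbrs G).1 h2.1
    exact ⟨((mem_highDegNbrs G).1 h1.1).1.2, h3.2, h3.1, h2.2.2⟩
  have hqX : (H.card : ℝ) * m ≤ 3 * (α : ℝ) ^ 2 * Q.card := by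
    have h1 : H.card * m ≤ α * ((2 * α + 1) * Q.card) := hUc.trans (Nat.mul_le_mul_left _ hQc)
    have h2 : α * ((2 * α + 1) * Q.card) ≤ 3 * α ^ 2 * Q.card := by
      have : α * (2 * α + 1) ≤ 3 * α ^ 2 := by nlinarith
      calc α * ((2 * α + 1) * Q.card) = α * (2 * α + 1) * Q.card := by ring
        _ ≤ _ := Nat.mul_le_mul_right _ this
    exact_mod_cast h1.trans h2
  -- Chosen so that τ(2D + α) = 1/4, the expected number of tall neighbors of a low-degree node
  -- being at most that. The first exposure needs 7/4 · 1/4 < 1/2.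
  set τ : ℝ := 1 / (8 * D + 4 * α) with hτdef
  have hτ0 : 0 < τ := by positivity
  have haD : (α : ℝ) ≤ D := by
    have h1 : (α : ℝ) ≤ (α : ℝ) ^ 10 := le_self_pow₀ ha (by norm_num)
    have h2 : (1 : ℝ) ≤ ℓ ^ 2 := by nlinarith
    have h3 : (α : ℝ) * 1 ≤ (α : ℝ) ^ 10 * ℓ ^ 2 := by gcongr
    have : 0 ≤ (α : ℝ) ^ 10 * ℓ ^ 2 := by positivity
    linarith
  have hτ1 : τ ≤ 1 := by
    rw [hτdef, div_le_one (by positivity)]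
    linarith
  have hτ : ∀ z, P.real {ω | 1 - τ < y z ω} = τ := fun z => by
    rw [hu z _ (by linarith) (by linarith)]; ring
  have hρ : rho G k = 4 * D * ℓ := rho_eq G k
  have hX0 : 0 < (H.card : ℝ) := lt_trans (by positivity) hX
  obtain ⟨T, hTQ, hTj, hTP⟩ := exists_survivors G hy hm (t := 1 - τ) (by linarith) hτ (A := A)
    (Q := Q) (x := x) (k := k) (d := 2 * D + α) (fun u hu => (hprop u hu).2.2.1) hQ
    (fun u hu => (hprop u hu).2.2.2) (by rw [hρ]; nlinarith) (by rw [hρ]; positivity) hτ0.le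
    (fun u hu z hz ω => hxy z (edist_le_three G (hprop u hu).1 (Or.inr (hprop u hu).2.1) hz) ω)
    (fun T Y => ((tallGroups H T g Y).card : ℝ) ≤ H.card / (176 * (α : ℝ) ^ 2))
    (ε := ENNReal.ofReal (exp (-ℓ))) (by
      intro T hT hTc
      rw [← ofReal_measureReal]
      refine ENNReal.ofReal_le_ofReal ?_
      refine (measureReal_tallGroups_le hy hm hτ hτ1 H T g (fun u hu => (hgU u (hQU (hT hu))).1)
        (m := m) (fun w hw => hgm w hw T (hT.trans hQU)) _ (fun ω u hu => ?_) _).trans ?_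
      · simp [hT hu]
      · refine exp_le_exp.2 (hit_exponent_le ha hℓ hD hX hmD ?_)
        have : (Q.card : ℝ) ≤ 2 * T.card := by exact_mod_cast hTc
        refine hqX.trans ?_
        have h6 : 3 * (α : ℝ) ^ 2 * Q.card ≤ 3 * (α : ℝ) ^ 2 * (2 * T.card) := by gcongr
        linarith)
  have hkill : ENNReal.ofReal (exp (-(Q.card / rho G k * (1 / 2 - 7 / 4 * (τ * (2 * D + α))))))
      ≤ ENNReal.ofReal (exp (-ℓ)) := by
    refine ENNReal.ofReal_le_ofReal (exp_le_exp.2 (neg_le_neg ?_))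
    have h1 : τ * (2 * D + α) = 1 / 4 := by rw [hτdef]; field_simp; ring
    rw [h1, hρ]
    refine kill_exponent_le ha hℓ hD hX (le_trans ?_ hqX)
    gcongr
  rw [two_mul, ENNReal.ofReal_add (exp_pos _).le (exp_pos _).le]
  refine le_trans (measure_mono ?_) (hTP.trans (by gcongr))
  intro ω hω
  simp only [Set.mem_ofPred_eq] at hω ⊢
  by_contra hlt
  rw [not_le] at hlt
  set Y := tallGroups H (T ω) g {u ∈ Q | 1 - τ < y u ω} with hYdef
  have hYH : Y ⊆ H := fun w hw => (mem_tallGroups.1 hw).1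
  have hsub : highDegNbrs G α k (iterActive G k A (x ω)) v ⊆ H \ Y := by
    intro w hw
    refine Finset.mem_sdiff.2 ⟨highDegNbrs_mono G (iterActive_subset G k A _) α k v hw, ?_⟩
    intro hwY
    rw [hYdef, mem_tallGroups] at hwY
    obtain ⟨-, u, huT, hgu, hut⟩ := hwY
    have hj := hTj ω u huT (Finset.mem_filter.1 hut).2
    have hadj : G.Adj u w := hgu ▸ (hprop u (hTQ ω huT)).2.1.symm
    exact notMem_iterActive_of_joining G hj hadj ((mem_highDegNbrs G).1 hw).1.1
  have hc := Finset.card_le_card hsub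
  have hc2 := Finset.card_sdiff_add_card_eq_card hYH
  have hc3 : ((highDegNbrs G α k (iterActive G k A (x ω)) v).card : ℝ) + Y.card ≤ H.card := by
    exact_mod_cast (by omega)
  have : (1 - 1 / (176 * (α : ℝ) ^ 2)) * (H.card : ℝ)
      = H.card - H.card / (176 * (α : ℝ) ^ 2) := by ring
  linarith

/-- While `v` has very many high-degree neighbors, an iteration very likely makes it inactive. -/
theorem measure_mem_iterActive_le (hy : iIndepFun y P) (hm : ∀ z, Measurable (y z))
    (hu : ∀ z, ∀ s, 0 ≤ s → s ≤ 1 → P.real {ω | s < y z ω} = 1 - s)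
    {α k : ℕ} {v : V} {A : Finset V} {x : Ω → V → ℝ}
    (hxy : ∀ z, G.edist v z ≤ 3 → ∀ ω, x ω z = y z ω)
    {par : V → Finset V}
    (hpar : ∀ v, (par v).card ≤ α) (hG : ∀ u v, G.Adj u v → v ∈ par u ∨ u ∈ par v)
    (hα : 1 ≤ α) (hℓ : 10 ≤ log (maxDeg G))
    (hD : 18816 * (α : ℝ) ^ 10 * log (maxDeg G) ^ 2 ≤ maxDeg G / 2 ^ k)
    (hv : v ∈ A) (hA : Sparse G α k A)
    (hX : 260 * (α : ℝ) ^ 4 * log (maxDeg G) ^ 2 * (maxDeg G / 2 ^ k / 4)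
      < ((highDegNbrs G α k A v).card : ℝ)) :
    P {ω | v ∈ iterActive G k A (x ω)} ≤ ENNReal.ofReal (2 * exp (-log (maxDeg G))) := by
  classical
  set D := maxDeg G / 2 ^ k with hDdef
  set ℓ := log (maxDeg G) with hℓdef
  set H := highDegNbrs G α k A v with hH
  have ha : (1 : ℝ) ≤ α := by exact_mod_cast hα
  have hD0 : 0 < D := lt_of_lt_of_le (by positivity) hD
  -- Now the high-degree neighbors of `v` themselves compete: by `Sparse` at `v`, all but D/2 have
  -- degree at most 2D + α, and a single one joining removes `v`.
  let U : Finset V := {w ∈ H | (activeDeg G A w : ℝ) ≤ 2 * D + α}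
  obtain ⟨Q, hQU, hQ, hQc⟩ := exists_independent_subset hpar hG U
  have hprop : ∀ u ∈ Q, G.Adj v u ∧ u ∈ A ∧ (activeDeg G A u : ℝ) ≤ 2 * D + α := by
    intro u hu
    have h1 := Finset.mem_filter.1 (hQU hu)
    have h2 := (mem_highDegNbrs G).1 h1.1
    exact ⟨h2.1.2, h2.1.1, h1.2⟩
  have hUc : (H.card : ℝ) ≤ U.card + D / 2 := by
    have hsub : H ⊆ U ∪ ({w ∈ activeNbrs G A v | (activeDeg G A w : ℝ) > 2 * D + α} :
        Finset V) := by
      intro w hw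
      by_cases hl : (activeDeg G A w : ℝ) ≤ 2 * D + α
      · exact Finset.mem_union_left _ (Finset.mem_filter.2 ⟨hw, hl⟩)
      · exact Finset.mem_union_right _
          (Finset.mem_filter.2 ⟨(Finset.mem_filter.1 hw).1, not_le.1 hl⟩)
    have h1 := (Finset.card_le_card hsub).trans (Finset.card_union_le _ _)
    have h2 : (H.card : ℝ) ≤ U.card + ({w ∈ activeNbrs G A v |
        (activeDeg G A w : ℝ) > 2 * D + α} : Finset V).card := by exact_mod_cast h1
    have h3 := hA v hv
    linarith
  have hℓ2 : (100 : ℝ) ≤ ℓ ^ 2 := by nlinarith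
  have haD : 1000 * (α : ℝ) ≤ D := by
    have h1 : (α : ℝ) ≤ (α : ℝ) ^ 10 := le_self_pow₀ ha (by norm_num)
    have h3 : (α : ℝ) * 100 ≤ (α : ℝ) ^ 10 * ℓ ^ 2 := by gcongr
    linarith
  have hq : 21 * ℓ ^ 2 * D ≤ Q.card := by
    have h1 : (U.card : ℝ) ≤ (2 * α + 1) * Q.card := by exact_mod_cast hQc
    have h2 : (2 * (α : ℝ) + 1) * Q.card ≤ 3 * α * Q.card := by gcongr; linarith
    have h3 : (α : ℝ) ≤ (α : ℝ) ^ 4 := le_self_pow₀ ha (by norm_num)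
    have h4 : (α : ℝ) * ℓ ^ 2 * D ≤ (α : ℝ) ^ 4 * ℓ ^ 2 * D := by gcongr
    have h5 : 1 * 1 * D ≤ (α : ℝ) * ℓ ^ 2 * D := by gcongr; linarith
    have h6 : 63 * ((α : ℝ) * ℓ ^ 2 * D) ≤ 3 * α * Q.card := by linarith
    refine le_of_mul_le_mul_left (a := 3 * (α : ℝ)) ?_ (by positivity)
    linarith
  -- Now τ(2D + α) = 1/8, and since |T| ≥ |Q|/2 ≥ 10.5·ℓ²D, the product |T|·τ still exceeds ℓ.
  set τ : ℝ := 1 / (16 * D + 8 * α) with hτdef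
  have hτ0 : 0 < τ := by positivity
  have hτ1 : τ ≤ 1 := by
    rw [hτdef, div_le_one (by positivity)]
    linarith
  have hτ : ∀ z, P.real {ω | 1 - τ < y z ω} = τ := fun z => by
    rw [hu z _ (by linarith) (by linarith)]; ring
  have hρ : rho G k = 4 * D * ℓ := rho_eq G k
  obtain ⟨T, hTQ, hTj, hTP⟩ := exists_survivors G hy hm (t := 1 - τ) (by linarith) hτ (A := A)
    (Q := Q) (x := x) (k := k) (d := 2 * D + α) (fun u hu => (hprop u hu).2.1) hQ
    (fun u hu => (hprop u hu).2.2) (by rw [hρ]; nlinarith) (by rw [hρ]; positivity) hτ0.le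
    (fun u hu z hz ω => hxy z (edist_le_three G (hprop u hu).1 (Or.inl rfl) hz) ω)
    (fun T Y => ∀ u ∈ T, u ∉ Y)
    (ε := ENNReal.ofReal (exp (-ℓ))) (by
      intro T hT hTc
      have h1 : {ω | ∀ u ∈ T, u ∉ ({u ∈ Q | 1 - τ < y u ω} : Finset V)}
          = {ω | ∀ u ∈ T, y u ω ≤ 1 - τ} := by
        ext ω
        simp only [Set.mem_ofPred_eq, Finset.mem_filter, not_and, not_lt]
        exact ⟨fun h u hu => h u hu (hT hu), fun h u hu _ => h u hu⟩
      rw [h1, ← ofReal_measureReal, measureReal_forall_not_tall hy hm hτ]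
      refine ENNReal.ofReal_le_ofReal ?_
      have h2 : (1 - τ) ^ T.card ≤ exp (-τ) ^ T.card :=
        pow_le_pow_left₀ (by linarith) (one_sub_le_exp_neg τ) _
      refine h2.trans ?_
      rw [← exp_nat_mul, exp_le_exp]
      have h3 : (Q.card : ℝ) ≤ 2 * T.card := by exact_mod_cast hTc
      have h4 : ℓ ≤ T.card * τ := by
        rw [hτdef, mul_one_div, le_div_iff₀ (by positivity)]
        have h5 : ℓ * (16 * D + 8 * α) ≤ ℓ * (17 * D) := by gcongr; linarith
        have h6 : ℓ * 10 * D ≤ ℓ * ℓ * D := by gcongr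
        have h7 : 0 ≤ ℓ * D := by positivity
        nlinarith
      linarith)
  have hkill : ENNReal.ofReal (exp (-(Q.card / rho G k * (1 / 2 - 7 / 4 * (τ * (2 * D + α))))))
      ≤ ENNReal.ofReal (exp (-ℓ)) := by
    refine ENNReal.ofReal_le_ofReal (exp_le_exp.2 (neg_le_neg ?_))
    have h1 : τ * (2 * D + α) = 1 / 8 := by rw [hτdef]; field_simp; ring
    rw [h1, hρ, div_mul_eq_mul_div, le_div_iff₀ (by positivity)]
    have : 0 ≤ ℓ ^ 2 * D := by positivity
    linarith
  rw [two_mul, ENNReal.ofReal_add (exp_pos _).le (exp_pos _).le]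
  refine le_trans (measure_mono ?_) (hTP.trans (by gcongr))
  intro ω hω
  simp only [Set.mem_ofPred_eq] at hω ⊢
  intro u huT hut
  have hj := hTj ω u huT (Finset.mem_filter.1 hut).2
  exact notMem_iterActive_of_joining G hj (hprop u (hTQ ω huT)).1.symm hω

end OneStep

/-! ### Measurability of the states -/

section Measurability

variable {V : Type*} [Fintype V] [DecidableEq V] (G : SimpleGraph V) [DecidableRel G.Adj]
  {Ω : Type*} [MeasurableSpace Ω]

instance : Finite (State V) :=
  Finite.of_injective (fun s : State V => (s.I, s.B, s.active)) fun s t h => by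
    cases s; cases t; simp_all

theorem measurable_priority (k : ℕ) (A : Finset V) {x : Ω → V → ℝ}
    (hx : ∀ v, Measurable fun ω => x ω v) (v : V) :
    Measurable fun ω => priority G k A (x ω) v := by
  unfold priority
  split_ifs
  · exact measurable_const
  · exact hx v

theorem measurableSet_joining_eq (k : ℕ) (A J : Finset V) {x : Ω → V → ℝ}
    (hx : ∀ v, Measurable fun ω => x ω v) :
    MeasurableSet {ω | joining G k A (x ω) = J} := by
  have hmem : ∀ v, MeasurableSet {ω | v ∈ joining G k A (x ω)} := by
    intro v
    have : {ω | v ∈ joining G k A (x ω)} = {_ω : Ω | v ∈ A} ∩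
        ⋂ w ∈ activeNbrs G A v, {ω | priority G k A (x ω) w < priority G k A (x ω) v} := by
      ext ω
      simp [joining]
    rw [this]
    exact (MeasurableSet.const _).inter (Finset.measurableSet_biInter _ fun w _ =>
      measurableSet_lt (measurable_priority G k A hx w) (measurable_priority G k A hx v))
  have : {ω | joining G k A (x ω) = J}
      = ⋂ v : V, {ω | v ∈ joining G k A (x ω) ↔ v ∈ J} := by
    ext ω
    simp [Finset.ext_iff]
  rw [this]
  exact MeasurableSet.iInter fun v => (hmem v).iff (MeasurableSet.const _)

/-- Only finitely many pairs of a state and a joining set occur, so the preimage splits into a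
finite union. -/
theorem measurableSet_iterStep (k : ℕ) {x : Ω → V → ℝ} (hx : ∀ v, Measurable fun ω => x ω v)
    {S : Ω → State V} (hS : ∀ T : Set (State V), MeasurableSet (S ⁻¹' T)) (T : Set (State V)) :
    MeasurableSet ((fun ω => iterStep G k (x ω) (S ω)) ⁻¹' T) := by
  have : (fun ω => iterStep G k (x ω) (S ω)) ⁻¹' T
      = ⋃ (σ : State V) (J : Finset V), (S ⁻¹' {σ} ∩ {ω | joining G k σ.active (x ω) = J}) ∩
        {_ω : Ω | (⟨σ.I ∪ J, σ.B, σ.active \ (J ∪ J.biUnion (activeNbrs G σ.active))⟩ : State V)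
          ∈ T} := by
    ext ω
    simp only [Set.mem_preimage, Set.mem_iUnion, Set.mem_inter_iff, Set.mem_singleton_iff,
      Set.mem_ofPred_eq]
    constructor
    · intro h
      exact ⟨S ω, _, ⟨rfl, rfl⟩, h⟩
    · rintro ⟨σ, J, ⟨rfl, rfl⟩, h⟩
      exact h
  rw [this]
  exact MeasurableSet.iUnion fun σ => MeasurableSet.iUnion fun J =>
    ((hS _).inter (measurableSet_joining_eq G k _ _ hx)).inter (MeasurableSet.const _)

theorem measurableSet_afterIters (k : ℕ) {X : Ω → Choices V}
    (hX : ∀ c, Measurable fun ω => X ω c)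
    {S : Ω → State V} (hS : ∀ T : Set (State V), MeasurableSet (S ⁻¹' T)) (i : ℕ)
    (T : Set (State V)) :
    MeasurableSet ((fun ω => afterIters G k (X ω) (S ω) i) ⁻¹' T) := by
  induction i generalizing T with
  | zero => exact hS T
  | succ i ih => exact measurableSet_iterStep G k (fun v => hX (k, i, v)) ih T

theorem measurableSet_afterScale (α : ℕ) (p : ℝ) {X : Ω → Choices V}
    (hX : ∀ c, Measurable fun ω => X ω c) (k : ℕ) (T : Set (State V)) :
    MeasurableSet ((fun ω => afterScale G α p (X ω) k) ⁻¹' T) := by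
  induction k generalizing T with
  | zero => exact MeasurableSet.const ((⟨∅, ∅, Finset.univ⟩ : State V) ∈ T)
  | succ k ih => exact measurableSet_afterIters G (k + 1) hX ih _ (markStep G α (k + 1) ⁻¹' T)

end Measurability

/-! ### Independence and law of the choices -/

section Choices

open ProbabilityTheory

variable {V : Type*}

instance : IsProbabilityMeasure (choiceMeasure V) := by
  unfold choiceMeasure; infer_instance

theorem iIndepFun_choices (k i : ℕ) :
    iIndepFun (fun (z : V) (ω : Choices V) => ω (k, i, z)) (choiceMeasure V) := by
  have h := iIndepFun_infinitePi (P := fun _ : ℕ × ℕ × V => uniform01)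
    (X := fun _ => (id : ℝ → ℝ)) fun _ => measurable_id
  exact h.precomp (g := fun z : V => (k, i, z)) fun a b hab => by simpa using hab

theorem measureReal_choice_gt (c : ℕ × ℕ × V) {s : ℝ} (h0 : 0 ≤ s) (h1 : s ≤ 1) :
    (choiceMeasure V).real {ω | s < ω c} = 1 - s := by
  have hmap : (choiceMeasure V).map (fun ω => ω c) = uniform01 :=
    Measure.infinitePi_map_eval (fun _ : ℕ × ℕ × V => uniform01) c
  have h2 : (choiceMeasure V) {ω | s < ω c} = uniform01 (Set.Ioi s) := by
    rw [← hmap, Measure.map_apply (measurable_pi_apply c) measurableSet_Ioi]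
    rfl
  have h3 : Set.Ioi s ∩ Set.Ioo 0 1 = Set.Ioo s 1 := by
    ext r
    simp only [Set.mem_inter_iff, Set.mem_Ioi, Set.mem_Ioo]
    constructor
    · rintro ⟨a, -, b⟩; exact ⟨a, b⟩
    · rintro ⟨a, b⟩; exact ⟨a, h0.trans_lt a, b⟩
  rw [measureReal_def, h2, uniform01, Measure.restrict_apply measurableSet_Ioi, h3, Real.volume_Ioo,
    ENNReal.toReal_ofReal (by linarith)]

end Choices

/-! ### Numerical estimates -/

section Numeric

open Real

/-- Bootstrapping: a lower bound on ln Δ improves the one on Δ through `h`, which improves the one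
on ln Δ, from 0.69 to 9 to 10. -/
theorem ten_le_log {Δ : ℝ} (hΔ : 2 ≤ Δ) (h : 37632 * log Δ ^ 2 ≤ Δ) : 10 ≤ log Δ := by
  have hlog : ∀ n : ℕ, (2.7182818286 : ℝ) ^ n ≤ Δ → (n : ℝ) ≤ log Δ := by
    intro n hn
    rw [le_log_iff_exp_le (by linarith), ← mul_one (n : ℝ), exp_nat_mul]
    exact (pow_le_pow_left₀ (exp_pos 1).le exp_one_lt_d9.le n).trans hn
  have h1 : 0.69 ≤ log Δ := by
    have := log_two_gt_d9
    have := log_le_log (by norm_num) hΔ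
    linarith
  have h2 : 17000 ≤ Δ := by nlinarith
  have h3 : (9 : ℕ) ≤ log Δ := hlog 9 (le_trans (by norm_num) h2)
  push_cast at h3
  have h4 : 3000000 ≤ Δ := by nlinarith
  have h5 := hlog 10 (le_trans (by norm_num) h4)
  exact_mod_cast h5

/-- The numerical consequences of there being at least `k ≥ 1` scales. -/
theorem scale_bounds {V : Type*} [Fintype V] [DecidableEq V] (G : SimpleGraph V)
    [DecidableRel G.Adj] {α k : ℕ} (hk : 1 ≤ k) (hkΘ : k ≤ numScales G α) :
    1 ≤ α ∧ 10 ≤ log (maxDeg G) ∧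
      18816 * (α : ℝ) ^ 10 * log (maxDeg G) ^ 2 ≤ maxDeg G / 2 ^ k := by
  have hΔ0 : 0 ≤ maxDeg G := by unfold maxDeg; positivity
  set R := maxDeg G / (1176 * 16 * (α : ℝ) ^ 10 * log (maxDeg G) ^ 2) with hR
  have hk' : (k : ℝ) ≤ logb 2 R := (Nat.le_floor_iff' (by omega)).1 hkΘ
  have hR0 : 0 ≤ R := by positivity
  -- If α = 0 or ln Δ = 0, division by zero makes `R` zero, and then its `logb` is 0 < k. This
  -- excludes the degenerate graphs.
  have hRne : R ≠ 0 := by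
    intro h
    rw [h, logb_zero] at hk'
    have : (1 : ℝ) ≤ k := by exact_mod_cast hk
    linarith
  have hRpos : 0 < R := lt_of_le_of_ne hR0 hRne.symm
  rw [le_logb_iff_rpow_le (by norm_num) hRpos, rpow_natCast] at hk'
  have hden : (1176 * 16 * (α : ℝ) ^ 10 * log (maxDeg G) ^ 2) ≠ 0 := by
    intro h; apply hRne; rw [hR, h, div_zero]
  have hden0 : 0 < (1176 * 16 * (α : ℝ) ^ 10 * log (maxDeg G) ^ 2) :=
    lt_of_le_of_ne (by positivity) hden.symm
  have hα : 1 ≤ α := by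
    rcases Nat.eq_zero_or_pos α with h | h
    · exfalso; apply hden; rw [h]; simp
    · exact h
  have hlog : log (maxDeg G) ≠ 0 := by
    intro h; apply hden; rw [h]; simp
  have hΔ2 : 2 ≤ maxDeg G := by
    unfold maxDeg at hlog ⊢
    have h0 : G.maxDegree ≠ 0 := by intro h; apply hlog; rw [h]; simp
    have h1 : G.maxDegree ≠ 1 := by intro h; apply hlog; rw [h]; simp
    have : 2 ≤ G.maxDegree := by omega
    exact_mod_cast this
  rw [hR, le_div_iff₀ hden0] at hk'
  have ha : (1 : ℝ) ≤ (α : ℝ) ^ 10 := one_le_pow₀ (by exact_mod_cast hα)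
  have h2k : (2 : ℝ) ≤ 2 ^ k := le_self_pow₀ (by norm_num) (by omega)
  refine ⟨hα, ten_le_log hΔ2 ?_, ?_⟩
  · have : 2 * (1176 * 16 * 1 * log (maxDeg G) ^ 2)
        ≤ 2 ^ k * (1176 * 16 * (α : ℝ) ^ 10 * log (maxDeg G) ^ 2) := by gcongr
    linarith
  · rw [le_div_iff₀ (by positivity)]
    linarith

/-- The decay rate of the potential in one iteration. -/
theorem decay_le {a ℓ Δ c θ : ℝ} (ha : 1 ≤ a) (hℓ : 10 ≤ ℓ) (hΔ : exp ℓ = Δ)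
    (hD : 18816 * a ^ 10 * ℓ ^ 2 ≤ Δ) (hc1 : 1 ≤ c) (hcℓ : c ≤ ℓ) (hθ : θ = 8 * ℓ / c) :
    (1 - 1 / (176 * a ^ 2)) ^ θ + 2 * exp (-ℓ) ≤ exp (-(5 / 4 * θ / (264 * a ^ 2))) := by
  have hc0 : 0 < c := by linarith
  have hθ8 : 8 ≤ θ := by rw [hθ, le_div_iff₀ hc0]; linarith
  have hθℓ : θ ≤ 8 * ℓ := by rw [hθ, div_le_iff₀ hc0]; nlinarith
  have ha2 : 1 ≤ a ^ 2 := one_le_pow₀ ha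
  -- As 264/176 = 3/2, the power is at most exp(-3s/2), while the target is exp(-5s/4). The spare
  -- factor exp(s/4) absorbs 2·exp(-ℓ), because s ≥ 1/(33a²) and s ≤ ℓ/33.
  set s := θ / (264 * a ^ 2) with hs
  have hs1 : 1 / (33 * a ^ 2) ≤ s := by
    rw [hs, div_le_div_iff₀ (by positivity) (by positivity)]
    nlinarith
  have hs2 : s ≤ ℓ / 33 := by
    rw [hs, div_le_div_iff₀ (by positivity) (by norm_num)]
    nlinarith
  have h1 : (1 - 1 / (176 * a ^ 2)) ^ θ ≤ exp (-(3 / 2 * s)) := by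
    have h2 : 0 ≤ 1 - 1 / (176 * a ^ 2) := by
      rw [sub_nonneg, div_le_one (by positivity)]; linarith
    refine (rpow_le_rpow h2 (one_sub_le_exp_neg _) (by linarith)).trans (le_of_eq ?_)
    rw [← exp_mul, hs]
    congr 1
    field_simp
    norm_num
  have h3 : exp (-(5 / 4 * θ / (264 * a ^ 2))) = exp (-(3 / 2 * s)) * exp (s / 4) := by
    rw [← exp_add, hs]
    congr 1
    field_simp
    norm_num
  have h4 : 1 + s / 4 ≤ exp (s / 4) := by linarith [add_one_le_exp (s / 4)]
  have h5 : exp (-(ℓ / 2)) ≤ exp (-(3 / 2 * s)) := exp_le_exp.2 (by linarith)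
  have h6 : 264 * a ^ 2 ≤ exp (ℓ / 2) := by
    have e : exp (ℓ / 2) ^ 2 = Δ := by rw [← hΔ, ← exp_nat_mul]; congr 1; push_cast; ring
    refine le_of_sq_le_sq ?_ (exp_pos _).le
    rw [e]
    have : a ^ 4 * 10 ^ 2 ≤ a ^ 10 * ℓ ^ 2 := by gcongr; norm_num
    have : 0 ≤ a ^ 4 := by positivity
    nlinarith
  have h7 : exp (-ℓ) = exp (-(ℓ / 2)) * exp (-(ℓ / 2)) := by rw [← exp_add]; congr 1; ring
  have h8 : exp (-(ℓ / 2)) ≤ 1 / (264 * a ^ 2) := by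
    rw [exp_neg, ← one_div]
    exact one_div_le_one_div_of_le (by positivity) h6
  have h9 : 2 * exp (-ℓ) ≤ exp (-(3 / 2 * s)) * (s / 4) := by
    have : 2 * exp (-(ℓ / 2)) ≤ s / 4 := by
      have : 1 / (33 * a ^ 2) = 8 * (1 / (264 * a ^ 2)) := by field_simp; norm_num
      linarith
    calc 2 * exp (-ℓ) = exp (-(ℓ / 2)) * (2 * exp (-(ℓ / 2))) := by rw [h7]; ring
      _ ≤ exp (-(3 / 2 * s)) * (s / 4) := by gcongr
  rw [h3]
  nlinarith [exp_pos (-(3 / 2 * s))]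

/-- The potential decays enough over all the iterations of a scale. -/
theorem total_decay_le {a ℓ Δ C θ p : ℝ} {Λ : ℕ} (ha : 1 ≤ a) (hℓ : 10 ≤ ℓ) (hΔ : exp ℓ = Δ)
    (hC : 1 < C) (hp : 1 ≤ p) (hθ : θ = 8 * ℓ / log C)
    (hΛ : p * (8 * a ^ 2 * (32 * a ^ 6 + 1)) * log C ≤ Λ) :
    C ^ θ * exp (-(5 / 4 * θ / (264 * a ^ 2))) ^ Λ ≤ 1 / Δ ^ (2 * p) := by
  have hlC : 0 < log C := log_pos hC
  have hθ0 : 0 < θ := by rw [hθ]; positivity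
  have hΛ' : p * (264 * a ^ 2) * log C ≤ Λ := by
    refine le_trans ?_ hΛ
    have : 1 ≤ a ^ 6 := one_le_pow₀ ha
    have : 264 * a ^ 2 ≤ 8 * a ^ 2 * (32 * a ^ 6 + 1) := by nlinarith [sq_nonneg a]
    gcongr
  -- Thus C^θ = Δ^8, the iterations contribute at most Δ^(-10p), and 8 - 10p ≤ -2p because p ≥ 1.
  have hθC : θ * log C = 8 * ℓ := by rw [hθ]; field_simp
  rw [← hΔ, ← exp_mul, one_div, ← exp_neg, ← exp_nat_mul, rpow_def_of_pos (by linarith), ← exp_add,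
    exp_le_exp]
  have h1 : p * (264 * a ^ 2) * log C * (5 / 4 * θ / (264 * a ^ 2))
      ≤ Λ * (5 / 4 * θ / (264 * a ^ 2)) := by gcongr
  have h2 : p * (264 * a ^ 2) * log C * (5 / 4 * θ / (264 * a ^ 2)) = 5 / 4 * p * (8 * ℓ) := by
    rw [← hθC]; field_simp
  nlinarith

end Numeric

/-! ### The potential and its decay -/

section Potential

open ProbabilityTheory Real

variable {V : Type*} [Fintype V] [DecidableEq V] (G : SimpleGraph V) [DecidableRel G.Adj]

/-- The potential of an active set in scale `k`: the `θ`-th power of the number of high-degree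
neighbors of `v`, truncated at `M`, if `v` is in danger of being marked, and zero otherwise. -/
noncomputable def potential (α k : ℕ) (v : V) (M θ : ℝ) (A : Finset V) : ENNReal :=
  if v ∈ A ∧ maxDeg G / 2 ^ k / 4 < ((highDegNbrs G α k A v).card : ℝ) then
    ENNReal.ofReal (min ((highDegNbrs G α k A v).card : ℝ) M ^ θ) else 0

variable {G} {α k : ℕ} {v : V} {M θ : ℝ}

theorem potential_le {A : Finset V} (hM : 0 ≤ M) (hθ : 0 ≤ θ) :
    potential G α k v M θ A ≤ ENNReal.ofReal (M ^ θ) := by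
  unfold potential
  split_ifs
  · exact ENNReal.ofReal_le_ofReal
      (rpow_le_rpow (le_min (Nat.cast_nonneg _) hM) (min_le_right _ _) hθ)
  · exact zero_le

/-- An unlucky iteration therefore costs only a factor 1. -/
theorem potential_mono {A A' : Finset V} (hM : 0 ≤ M) (hθ : 0 ≤ θ) (h : A' ⊆ A) :
    potential G α k v M θ A' ≤ potential G α k v M θ A := by
  have hc : ((highDegNbrs G α k A' v).card : ℝ) ≤ (highDegNbrs G α k A v).card :=
    Nat.cast_le.2 (Finset.card_le_card (highDegNbrs_mono G h α k v))
  unfold potential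
  by_cases h1 : v ∈ A' ∧ maxDeg G / 2 ^ k / 4 < ((highDegNbrs G α k A' v).card : ℝ)
  · rw [if_pos h1, if_pos ⟨h h1.1, h1.2.trans_le hc⟩]
    exact ENNReal.ofReal_le_ofReal
      (rpow_le_rpow (le_min (Nat.cast_nonneg _) hM) (min_le_min_right _ hc) hθ)
  · rw [if_neg h1]; exact zero_le

/-- `hXM` matters: above `M` the truncation could hide a decrease of the count. -/
theorem potential_le_mul {A A' : Finset V} {b : ℝ} (hb : 0 ≤ b) (hM : 0 ≤ M) (hθ : 0 ≤ θ)
    (hA : v ∈ A) (hX : maxDeg G / 2 ^ k / 4 < ((highDegNbrs G α k A v).card : ℝ))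
    (hXM : ((highDegNbrs G α k A v).card : ℝ) ≤ M)
    (h : ((highDegNbrs G α k A' v).card : ℝ) ≤ b * (highDegNbrs G α k A v).card) :
    potential G α k v M θ A' ≤ ENNReal.ofReal (b ^ θ) * potential G α k v M θ A := by
  have e : potential G α k v M θ A = ENNReal.ofReal (((highDegNbrs G α k A v).card : ℝ) ^ θ) := by
    rw [potential, if_pos ⟨hA, hX⟩, min_eq_left hXM]
  rw [e, ← ENNReal.ofReal_mul (rpow_nonneg hb _), ← mul_rpow hb (Nat.cast_nonneg _)]
  unfold potential
  split_ifs
  · exact ENNReal.ofReal_le_ofReal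
      (rpow_le_rpow (le_min (Nat.cast_nonneg _) hM) ((min_le_left _ _).trans h) hθ)
  · exact zero_le

/-- The factor is `b` off an event of probability at most `δ` and 1 on it. Only upper bounds on
integrals are used, so `f` need not be measurable. -/
theorem lintegral_le_of_measure_lt_le {Ω : Type*} [MeasurableSpace Ω] {P : Measure Ω}
    [IsProbabilityMeasure P] {f : Ω → ENNReal} {B b δ : ENNReal} (hB : ∀ ω, f ω ≤ B)
    (h : P {ω | b * B < f ω} ≤ δ) : ∫⁻ ω, f ω ∂P ≤ (b + δ) * B := by
  calc ∫⁻ ω, f ω ∂P ≤ ∫⁻ ω, {ω | b * B < f ω}.indicator (fun _ => B) ω + b * B ∂P := by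
        refine lintegral_mono fun ω => ?_
        by_cases hω : b * B < f ω
        · rw [Set.indicator_of_mem (show ω ∈ {ω | b * B < f ω} from hω)]
          exact (hB ω).trans le_self_add
        · exact (not_lt.1 hω).trans le_add_self
    _ = (∫⁻ ω, {ω | b * B < f ω}.indicator (fun _ => B) ω ∂P) + b * B := by
        rw [lintegral_add_right _ measurable_const]; simp
    _ ≤ B * P {ω | b * B < f ω} + b * B := by
        gcongr; exact lintegral_indicator_const_le _ _
    _ ≤ B * δ + b * B := by gcongr
    _ = (b + δ) * B := by ring

/-- The potential decays in expectation in every iteration. -/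
theorem lintegral_potential_iterActive_le {Ω : Type*} [MeasurableSpace Ω] {P : Measure Ω}
    [IsProbabilityMeasure P] {y : V → Ω → ℝ} (hy : iIndepFun y P) (hm : ∀ z, Measurable (y z))
    (hu : ∀ z, ∀ s, 0 ≤ s → s ≤ 1 → P.real {ω | s < y z ω} = 1 - s)
    {A : Finset V} {x : Ω → V → ℝ} (hxy : ∀ z, G.edist v z ≤ 3 → ∀ ω, x ω z = y z ω)
    {par : V → Finset V} (hpar : ∀ v, (par v).card ≤ α)
    (hG : ∀ u v, G.Adj u v → v ∈ par u ∨ u ∈ par v)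
    (hα : 1 ≤ α) (hℓ : 10 ≤ log (maxDeg G))
    (hD : 18816 * (α : ℝ) ^ 10 * log (maxDeg G) ^ 2 ≤ maxDeg G / 2 ^ k)
    (hA : Sparse G α k A) (hθ : 0 ≤ θ)
    (hM : M = 260 * (α : ℝ) ^ 4 * log (maxDeg G) ^ 2 * (maxDeg G / 2 ^ k / 4)) :
    ∫⁻ ω, potential G α k v M θ (iterActive G k A (x ω)) ∂P
      ≤ ENNReal.ofReal ((1 - 1 / (176 * (α : ℝ) ^ 2)) ^ θ + 2 * exp (-log (maxDeg G)))
        * potential G α k v M θ A := by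
  have hD0 : 0 ≤ maxDeg G / 2 ^ k := le_trans (by positivity) hD
  have hM0 : 0 ≤ M := by rw [hM]; positivity
  have ha : (1 : ℝ) ≤ α := by exact_mod_cast hα
  have hb : 0 ≤ 1 - 1 / (176 * (α : ℝ) ^ 2) := by
    have : 1 ≤ (α : ℝ) ^ 2 := one_le_pow₀ ha
    rw [sub_nonneg, div_le_one (by positivity)]; linarith
  rw [ENNReal.ofReal_add (rpow_nonneg hb _) (by positivity)]
  refine lintegral_le_of_measure_lt_le
    (fun ω => potential_mono hM0 hθ (iterActive_subset G k A _)) ?_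
  by_cases hvA : v ∈ A ∧ maxDeg G / 2 ^ k / 4 < ((highDegNbrs G α k A v).card : ℝ)
  -- Up to `M` the count shrinks; above `M` the potential drops to 0 because `v` becomes inactive.
  · rcases le_or_gt ((highDegNbrs G α k A v).card : ℝ) M with hXM | hXM
    · refine le_trans (measure_mono fun ω hω => ?_)
        (measure_many_highDegNbrs_le G hy hm hu hxy hpar hG hα hℓ hD hA hvA.2)
      simp only [Set.mem_ofPred_eq] at hω ⊢
      by_contra hlt
      exact absurd (potential_le_mul hb hM0 hθ hvA.1 hvA.2 hXM (not_lt.1 hlt)) (not_le.2 hω)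
    · rw [hM] at hXM
      refine le_trans (measure_mono fun ω hω => ?_)
        (measure_mem_iterActive_le G hy hm hu hxy hpar hG hα hℓ hD hvA.1 hA hXM)
      simp only [Set.mem_ofPred_eq] at hω ⊢
      by_contra hn
      have h0 : potential G α k v M θ (iterActive G k A (x ω)) = 0 := if_neg fun h => hn h.1
      rw [h0] at hω
      exact absurd hω (not_lt.2 zero_le)
  · have h0 : potential G α k v M θ A = 0 := if_neg hvA
    have hemp : {ω | ENNReal.ofReal ((1 - 1 / (176 * (α : ℝ) ^ 2)) ^ θ)
        * potential G α k v M θ A < potential G α k v M θ (iterActive G k A (x ω))} = ∅ := by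
      ext ω
      simp only [Set.mem_ofPred_eq, Set.mem_empty_iff_false, iff_false, not_lt]
      rw [h0]
      exact (potential_mono hM0 hθ (iterActive_subset G k A _)).trans (h0.le.trans zero_le)
    rw [hemp, measure_empty]
    exact zero_le

end Potential

/-! ### The bound for a whole scale -/

section Main

open ProbabilityTheory Real

variable {V : Type*} [Fintype V] [DecidableEq V] {G : SimpleGraph V} [DecidableRel G.Adj]

theorem resampleNear_of_ne (v : V) {k : ℕ} (ω₀ ω : Choices V) {c : ℕ × ℕ × V} (hc : c.1 ≠ k) :
    resampleNear G v k ω₀ ω c = ω₀ c := by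
  simp [resampleNear, hc]

theorem measurable_resampleNear (v : V) (k : ℕ) (ω₀ : Choices V) (c : ℕ × ℕ × V) :
    Measurable fun ω => resampleNear G v k ω₀ ω c := by
  unfold resampleNear
  split_ifs
  · exact measurable_pi_apply c
  · exact measurable_const

/-- The expected potential after `i` iterations of a scale. -/
theorem lintegral_potential_afterIters_le {α k : ℕ} {v : V} {M θ q : ℝ}
    {par : V → Finset V} (hpar : ∀ v, (par v).card ≤ α)
    (hG : ∀ u v, G.Adj u v → v ∈ par u ∨ u ∈ par v)
    (hα : 1 ≤ α) (hℓ : 10 ≤ log (maxDeg G))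
    (hD : 18816 * (α : ℝ) ^ 10 * log (maxDeg G) ^ 2 ≤ maxDeg G / 2 ^ k) (hθ : 0 ≤ θ)
    (hM : M = 260 * (α : ℝ) ^ 4 * log (maxDeg G) ^ 2 * (maxDeg G / 2 ^ k / 4))
    (hq : (1 - 1 / (176 * (α : ℝ) ^ 2)) ^ θ + 2 * exp (-log (maxDeg G)) ≤ q)
    (ω₀ : Choices V) (s : State V) (hs : Sparse G α k s.active) (i : ℕ) :
    ∫⁻ ω, potential G α k v M θ (afterIters G k (resampleNear G v k ω₀ ω) s i).active
        ∂(choiceMeasure V)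
      ≤ ENNReal.ofReal q ^ i * ENNReal.ofReal (M ^ θ) := by
  classical
  have hD0 : 0 ≤ maxDeg G / 2 ^ k := le_trans (by positivity) hD
  have hM0 : 0 ≤ M := by rw [hM]; positivity
  induction i with
  | zero =>
    refine (lintegral_mono fun ω => potential_le hM0 hθ).trans ?_
    simp
  | succ i ih =>
    have hmeas : Measurable fun ω =>
        potential G α k v M θ (afterIters G k (resampleNear G v k ω₀ ω) s (i + 1)).active := by
      intro T _
      exact measurableSet_afterIters G k (measurable_resampleNear v k ω₀)
        (S := fun _ => s) (fun _ => MeasurableSet.const _) (i + 1)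
        ((fun σ : State V => potential G α k v M θ σ.active) ⁻¹' T)
    -- The inner integral is over the choices of iteration `i` alone: the state before it does not
    -- depend on them, and its values near `v` are fresh.
    let S : Set (ℕ × ℕ × V) := {c | c.1 = k ∧ c.2.1 = i}
    unfold choiceMeasure
    rw [lintegral_piecewise uniform01 S hmeas]
    have hin : ∀ ω₁ : Choices V,
        ∫⁻ ω, potential G α k v M θ
          (afterIters G k (resampleNear G v k ω₀ (S.piecewise ω ω₁)) s (i + 1)).active
          ∂(choiceMeasure V)
        ≤ ENNReal.ofReal q * potential G α k v M θ
          (afterIters G k (resampleNear G v k ω₀ ω₁) s i).active := by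
      intro ω₁
      have hst : ∀ ω, afterIters G k (resampleNear G v k ω₀ (S.piecewise ω ω₁)) s i
          = afterIters G k (resampleNear G v k ω₀ ω₁) s i := by
        intro ω
        refine afterIters_congr G s fun j hj z => ?_
        have : (k, j, z) ∉ S := fun h => hj.ne h.2
        simp only [resampleNear, Set.piecewise_eq_of_notMem _ _ _ this]
      simp_rw [afterIters_active_succ, hst]
      refine (lintegral_potential_iterActive_le (iIndepFun_choices k i)
        (fun z => measurable_pi_apply (k, i, z)) (fun z t => measureReal_choice_gt (k, i, z))
        (fun z hz ω => ?_) hpar hG hα hℓ hD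
        (hs.mono G (afterIters_active_subset G _ _ _ _)) hθ hM).trans ?_
      · have : (k, i, z) ∈ S := ⟨rfl, rfl⟩
        simp only [resampleNear, hz, and_self, if_true, Set.piecewise_eq_of_mem _ _ _ this]
      · gcongr
    refine (lintegral_mono hin).trans ?_
    rw [lintegral_const_mul' _ _ ENNReal.ofReal_ne_top, pow_succ', mul_assoc]
    gcongr
    exact ih

/-- The probability of being marked in a scale, over the choices in the `3`-neighborhood. -/
theorem measure_resampleNear_marked_le {α : ℕ} (hα : arboricity G = α) {p : ℝ} (hp : 1 ≤ p)
    {k : ℕ} (hk : 1 ≤ k) (hkΘ : k ≤ numScales G α) (v : V) (ω₀ : Choices V)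
    (hv : v ∈ (afterScale G α p ω₀ (k - 1)).active) :
    choiceMeasure V {ω | v ∈ (afterScale G α p (resampleNear G v k ω₀ ω) k).B}
      ≤ ENNReal.ofReal (1 / (G.maxDegree : ℝ) ^ (2 * p)) := by
  obtain ⟨hα1, hℓ, hD⟩ := scale_bounds G hk hkΘ
  have hpart : HasForestPartition G α := by
    -- The `sInf` of the empty set is 0, so α ≥ 1 shows that a forest partition exists.
    have hne : {a : ℕ | HasForestPartition G a}.Nonempty := by
      apply Nat.nonempty_of_pos_sInf
      change 0 < arboricity G
      omega
    exact hα ▸ Nat.sInf_mem hne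
  obtain ⟨par, hpar, hG⟩ := hpart.exists_orientation
  obtain ⟨j, rfl⟩ : ∃ j, k = j + 1 := ⟨k - 1, by omega⟩
  rw [Nat.add_sub_cancel] at hv
  set s := afterScale G α p ω₀ j with hs
  set D := maxDeg G / 2 ^ (j + 1) with hDdef
  set ℓ := log (maxDeg G) with hℓdef
  have ha : (1 : ℝ) ≤ α := by exact_mod_cast hα1
  have ha10 : (1 : ℝ) ≤ (α : ℝ) ^ 10 := one_le_pow₀ ha
  have ha4 : (1 : ℝ) ≤ (α : ℝ) ^ 4 := one_le_pow₀ ha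
  have hℓ2 : (100 : ℝ) ≤ ℓ ^ 2 := by nlinarith
  have hD0 : 0 < D := lt_of_lt_of_le (by positivity) hD
  have hΔ0 : 0 < maxDeg G := by
    rw [hDdef] at hD0
    exact (div_pos_iff_of_pos_right (by positivity)).1 hD0
  have hDΔ : D ≤ maxDeg G := div_le_self hΔ0.le (one_le_pow₀ (by norm_num))
  have hexp : exp ℓ = maxDeg G := exp_log hΔ0
  set C := 260 * (α : ℝ) ^ 4 * ℓ ^ 2 with hC
  have hC260 : 260 ≤ C := by
    have : 260 * 1 * 1 ≤ C := by rw [hC]; gcongr; linarith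
    linarith
  have hCΔ : C ≤ maxDeg G := by
    have : (α : ℝ) ^ 4 ≤ (α : ℝ) ^ 10 := pow_le_pow_right₀ ha (by norm_num)
    have h2 : C ≤ 18816 * (α : ℝ) ^ 10 * ℓ ^ 2 := by rw [hC]; gcongr; norm_num
    linarith
  have hlC1 : 1 ≤ log C := by
    rw [le_log_iff_exp_le (by linarith)]
    have := exp_one_lt_d9
    linarith
  have hlCℓ : log C ≤ ℓ := log_le_log (by linarith) hCΔ
  obtain ⟨θ, hθ⟩ : ∃ θ, θ = 8 * ℓ / log C := ⟨_, rfl⟩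
  have hθ0 : 0 ≤ θ := by rw [hθ]; positivity
  obtain ⟨q, hq⟩ : ∃ q, q = exp (-(5 / 4 * θ / (264 * (α : ℝ) ^ 2))) := ⟨_, rfl⟩
  have hdec := decay_le ha hℓ hexp (hD.trans hDΔ) hlC1 hlCℓ hθ
  rw [← hq] at hdec
  have hmain := lintegral_potential_afterIters_le (v := v) hpar hG hα1 hℓ hD hθ0 rfl hdec ω₀ s
    (sparse_afterScale G α p ω₀ j) (numIters G α p)
  set Λ := numIters G α p with hΛ
  have hΛle : p * (8 * (α : ℝ) ^ 2 * (32 * (α : ℝ) ^ 6 + 1)) * log C ≤ Λ := Nat.le_ceil _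
  have htot := total_decay_le (Λ := Λ) ha hℓ hexp (by linarith) hp hθ hΛle
  rw [← hq] at htot
  -- A marked `v` has X > D/4, hence potential at least (D/4)^θ. Against the initial bound
  -- (C·D/4)^θ, Markov's inequality loses exactly C^θ.
  have hsub : {ω | v ∈ (afterScale G α p (resampleNear G v (j + 1) ω₀ ω) (j + 1)).B}
      ⊆ {ω | ENNReal.ofReal ((D / 4) ^ θ) ≤ potential G α (j + 1) v (C * (D / 4)) θ
        (afterIters G (j + 1) (resampleNear G v (j + 1) ω₀ ω) s Λ).active} := by
    intro ω hω
    have hst : afterScale G α p (resampleNear G v (j + 1) ω₀ ω) j = s :=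
      afterScale_congr G fun i hi l z => resampleNear_of_ne v ω₀ ω (by simp; omega)
    simp only [Set.mem_ofPred_eq, afterScale, markStep, hst, afterIters_B] at hω ⊢
    have hvB : v ∉ s.B := Finset.disjoint_left.1 (afterScale_active_disjoint_B G α p ω₀ j) hv
    have hmk := (Finset.mem_union.1 hω).resolve_left hvB
    rw [marked, Finset.mem_filter] at hmk
    have e : maxDeg G / 2 ^ (j + 1 + 2) = D / 4 := by
      rw [hDdef, div_div, pow_add (2 : ℝ) (j + 1) 2]; norm_num
    rw [e] at hmk
    rw [potential, if_pos ⟨hmk.1, hmk.2⟩]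
    refine ENNReal.ofReal_le_ofReal (rpow_le_rpow (by positivity) (le_min hmk.2.le ?_) hθ0)
    nlinarith
  have hmarkov := (mul_meas_ge_le_lintegral₀ (μ := choiceMeasure V) (f := fun ω =>
      potential G α (j + 1) v (C * (D / 4)) θ
        (afterIters G (j + 1) (resampleNear G v (j + 1) ω₀ ω) s Λ).active)
      (Measurable.aemeasurable fun T _ =>
        measurableSet_afterIters G (j + 1) (measurable_resampleNear v (j + 1) ω₀)
          (S := fun _ => s) (fun _ => MeasurableSet.const _) Λ
          ((fun σ : State V => potential G α (j + 1) v (C * (D / 4)) θ σ.active) ⁻¹' T))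
      (ENNReal.ofReal ((D / 4) ^ θ))).trans hmain
  have hDθ : 0 < (D / 4) ^ θ := rpow_pos_of_pos (by positivity) θ
  have hq0 : 0 ≤ q := by rw [hq]; positivity
  have hrhs : ENNReal.ofReal q ^ Λ * ENNReal.ofReal ((C * (D / 4)) ^ θ)
      ≤ ENNReal.ofReal ((D / 4) ^ θ) * ENNReal.ofReal (1 / (G.maxDegree : ℝ) ^ (2 * p)) := by
    rw [← ENNReal.ofReal_pow hq0, ← ENNReal.ofReal_mul (by positivity),
      ← ENNReal.ofReal_mul hDθ.le, mul_rpow (by linarith) (by positivity)]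
    refine ENNReal.ofReal_le_ofReal ?_
    calc q ^ Λ * (C ^ θ * (D / 4) ^ θ) = (D / 4) ^ θ * (C ^ θ * q ^ Λ) := by ring
      _ ≤ (D / 4) ^ θ * (1 / (G.maxDegree : ℝ) ^ (2 * p)) := by gcongr; exact htot
  refine (measure_mono hsub).trans ?_
  refine (ENNReal.mul_le_mul_iff_right (ENNReal.ofReal_pos.2 hDθ).ne'
    ENNReal.ofReal_ne_top).1 (hmarkov.trans hrhs)

/-- `E` does not depend on the coordinates in `S`. Integrating over these first bounds the measure
of `E ∩ F` by `ε` times that of `E`. -/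
theorem cond_le_of_forall_resample {ι : Type*} {ν : Measure ℝ} [IsProbabilityMeasure ν]
    {E F : Set (ι → ℝ)} (hE : MeasurableSet E) (hF : MeasurableSet F) {r : (ι → ℝ) → (ι → ℝ) → ι → ℝ}
    {S : Set ι} [DecidablePred (· ∈ S)] (hr : ∀ ω₀ ω, r ω₀ ω = S.piecewise ω ω₀)
    (hEr : ∀ ω₀ ω, r ω₀ ω ∈ E ↔ ω₀ ∈ E) {ε : ENNReal}
    (h : ∀ ω₀ ∈ E, Measure.infinitePi (fun _ : ι => ν) {ω | r ω₀ ω ∈ F} ≤ ε) :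
    ProbabilityTheory.cond (Measure.infinitePi fun _ : ι => ν) E F ≤ ε := by
  set μ := Measure.infinitePi fun _ : ι => ν
  have hEF : μ (E ∩ F) ≤ ε * μ E := by
    rw [← lintegral_indicator_one (hE.inter hF),
      lintegral_piecewise ν S (measurable_one.indicator (hE.inter hF)), ← lintegral_indicator_const hE]
    refine lintegral_mono fun ω₀ => ?_
    by_cases h0 : ω₀ ∈ E
    · rw [Set.indicator_of_mem h0]
      refine le_trans ?_ (h ω₀ h0)
      rw [← one_mul (Measure.infinitePi (fun _ : ι => ν) {ω | r ω₀ ω ∈ F})]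
      refine le_trans (lintegral_mono fun ω => ?_) (lintegral_indicator_const_le _ _)
      by_cases hω : r ω₀ ω ∈ F
      · rw [Set.indicator_of_mem (show ω ∈ {ω | r ω₀ ω ∈ F} from hω)]
        exact Set.indicator_le_self' (by simp) _
      · rw [Set.indicator_of_notMem]
        · exact zero_le
        · rintro ⟨-, h2⟩
          apply hω
          rw [hr]
          exact h2
    · rw [Set.indicator_of_notMem h0]
      refine le_of_eq ?_
      rw [← lintegral_zero (μ := μ)]
      refine lintegral_congr fun ω => Set.indicator_of_notMem ?_ _
      rintro ⟨h2, -⟩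
      apply h0
      rw [← hEr ω₀ ω, hr]
      exact h2
  rw [ProbabilityTheory.cond_apply hE]
  calc (μ E)⁻¹ * μ (E ∩ F) ≤ (μ E)⁻¹ * (ε * μ E) := by gcongr
    _ = ε * ((μ E)⁻¹ * μ E) := by ring
    -- This form also covers the case that `E` has measure 0.
    _ ≤ ε * 1 := by gcongr; exact ENNReal.inv_mul_le_one _
    _ = ε := mul_one _

end Main

end BoundedArb

theorem mainTheorem3 {V : Type*} [Fintype V] [DecidableEq V] (G : SimpleGraph V)
    [DecidableRel G.Adj] (α : ℕ) (hα : BoundedArb.arboricity G = α) (p : ℝ) (hp : 1 ≤ p)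
    (k : ℕ) (hk : 1 ≤ k) (hkΘ : k ≤ BoundedArb.numScales G α) (v : V) :
    ProbabilityTheory.cond (BoundedArb.choiceMeasure V)
        {ω | v ∈ (BoundedArb.afterScale G α p ω (k - 1)).active}
        {ω | v ∈ (BoundedArb.afterScale G α p ω k).B}
      ≤ ENNReal.ofReal (1 / (G.maxDegree : ℝ) ^ (2 * p)) ∧
    ∀ ω₀ : BoundedArb.Choices V, (∀ c, ω₀ c ∈ Set.Ioo (0 : ℝ) 1) →
      v ∈ (BoundedArb.afterScale G α p ω₀ (k - 1)).active →
      BoundedArb.choiceMeasure V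
          {ω | v ∈ (BoundedArb.afterScale G α p (BoundedArb.resampleNear G v k ω₀ ω) k).B}
        ≤ ENNReal.ofReal (1 / (G.maxDegree : ℝ) ^ (2 * p)) := by
  classical
  refine ⟨?_, fun ω₀ _ hv => BoundedArb.measure_resampleNear_marked_le hα hp hk hkΘ v ω₀ hv⟩
  refine BoundedArb.cond_le_of_forall_resample
    (BoundedArb.measurableSet_afterScale G α p (X := id) (fun c => measurable_pi_apply c) (k - 1)
      {σ | v ∈ σ.active})
    (BoundedArb.measurableSet_afterScale G α p (X := id) (fun c => measurable_pi_apply c) k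
      {σ | v ∈ σ.B})
    (r := BoundedArb.resampleNear G v k) (S := {c | c.1 = k ∧ G.edist v c.2.2 ≤ 3})
    (fun ω₀ ω => ?_) (fun ω₀ ω => ?_)
    fun ω₀ hω₀ => BoundedArb.measure_resampleNear_marked_le hα hp hk hkΘ v ω₀ hω₀
  · funext c
    simp only [BoundedArb.resampleNear, Set.piecewise, Set.mem_ofPred_eq]
  · have : BoundedArb.afterScale G α p (BoundedArb.resampleNear G v k ω₀ ω) (k - 1)
        = BoundedArb.afterScale G α p ω₀ (k - 1) :=
      BoundedArb.afterScale_congr G fun j hj i z =>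
        BoundedArb.resampleNear_of_ne v ω₀ ω (by simp; omega)
    simp only [Set.mem_ofPred_eq, Set.mem_preimage, id, this]
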